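/- Let $n\ge 1$, $m\ge 0$, and let $\mathcal M=\{A,B,C,D\}$ with $A\in\mathbb C^{n\times n}$, $B\in\mathbb C^{n\times m}$, $C\in\mathbb C^{m\times n}$, $D\in\mathbb C^{m\times m}$ be a discrete-time state-space model with transfer function $\mathcal T(z)=C(zI_n-A)^{-1}B+D$. The model is minimal if $\operatorname{rank}[\,zI_n-A\;\;B\,]=\operatorname{rank}[\,zI_n-A^{\mathsf H}\;\;C^{\mathsf H}\,]=n$ for all $z\in\mathbb C$. Put $\Phi(e^{\imath\omega})=\mathcal T(e^{\imath\omega})^{\mathsf H}+\mathcal T(e^{\imath\omega})$. The system is strictly passive if all eigenvalues of $A$ lie in the open unit disc and $\Phi(e^{\imath\omega})>0$ for all $\omega\in[-\pi,\pi]$; it is passive if all eigenvalues of $A$ lie in the closed unit disc, those on the unit circle are semisimple, and $\Phi(e^{\imath\omega})\ge 0$ for all $\omega\in[-\pi,\pi]$ for which $e^{\imath\omega}$ is not an eigenvalue of $A$. For Hermitian $X\in\mathbb C^{n\times n}$ let $$W(X,\mathcal M)=\begin{bmatrix}X-A^{\mathsf H}XA & C^{\mathsf H}-A^{\mathsf H}XB\\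 C-B^{\mathsf H}XA & D^{\mathsf H}+D-B^{\mathsf H}XB\end{bmatrix},\qquad \widetilde W(X,\mathcal M)=\begin{bmatrix}X & XA & XB\\ A^{\mathsf H}X & X & C^{\mathsf H}\\ B^{\mathsf H}X & C & D^{\mathsf H}+D\end{bmatrix},$$ let $\mathbb X^{>}=\{X=X^{\mathsf H} : X>0,\ W(X,\mathcal M)\ge 0\}$, and let $\xi^*(X)$ be the largest real $\xi$ with $\widetilde W(X,\mathcal M)\ge\xi\,\mathrm{diag}(X,X,2I_m)$. For real $\xi<1$ let $\mathcal M_\xi=\left\{\frac{A}{1-\xi},\frac{B}{1-\xi},\frac{C}{1-\xi},\frac{D-\xi I_m}{1-\xi}\right\}$, with transfer function $\mathcal T_\xi$. **Theorem.** Let $\mathcal M$ be minimal and strictly passive. Then $\Xi:=\sup\{\xi<1 : \mathcal T_\xi \text{ is strictly passive}\}$ is finite and $\Xi<1$, and 1. $\mathcal T_\Xi$ is passive; 2. the set $\{X>0 : \widetilde W(X,\mathcal M_\Xi)\ge 0\}$ is not empty; 3. the set $\{X>0 : \widetilde W(X,\mathcal M_\Xi)>0\}$ is empty; 4. for every real $\xi<\Xi$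 the set $\{X>0 : \widetilde W(X,\mathcal M_\xi)>0\}$ is not empty; 5. the maximum $\xi^*(X)$ exists for every $X\in\mathbb X^{>}$, and $\Xi=\sup_{X\in\mathbb X^{>}}\xi^*(X)$. -/

import Mathlib

open Matrix
open scoped ComplexOrder

noncomputable section

/-- A discrete-time state-space model `x_{k+1} = A x_k + B u_k`, `y_k = C x_k + D u_k`
with `n` states, `m` inputs and `m` outputs. -/
@[ext]
structure StateSpaceModel (n m : ℕ) where
  A : Matrix (Fin n) (Fin n) ℂ
  B : Matrix (Fin n) (Fin m) ℂ
  C : Matrix (Fin m) (Fin n) ℂ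
  D : Matrix (Fin m) (Fin m) ℂ

/-- `(A, B)` is controllable: `rank [zI - A, B] = n` for all complex `z`. -/
def IsControllablePair {n m : ℕ} (A : Matrix (Fin n) (Fin n) ℂ)
    (B : Matrix (Fin n) (Fin m) ℂ) : Prop :=
  ∀ z : ℂ, (fromCols (z • (1 : Matrix (Fin n) (Fin n) ℂ) - A) B).rank = n

/-- `(A, C)` is observable: `(Aᴴ, Cᴴ)` is controllable. -/
def IsObservablePair {n m : ℕ} (A : Matrix (Fin n) (Fin n) ℂ)
    (C : Matrix (Fin m) (Fin n) ℂ) : Prop :=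
  IsControllablePair Aᴴ Cᴴ

namespace StateSpaceModel

variable {n m : ℕ}

/-- Minimality: controllable and observable. -/
def IsMinimal (M : StateSpaceModel n m) : Prop :=
  IsControllablePair M.A M.B ∧ IsObservablePair M.A M.C

/-- The transfer function `T(z) = C (zI - A)⁻¹ B + D` (meaningful when `z` is not an
eigenvalue of `A`). -/
def transfer (M : StateSpaceModel n m) (z : ℂ) : Matrix (Fin m) (Fin m) ℂ :=
  M.C * (z • (1 : Matrix (Fin n) (Fin n) ℂ) - M.A)⁻¹ * M.B + M.D

/-- `Φ(e^{iω}) = T(e^{iω})ᴴ + T(e^{iω})`. -/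
def Phi (M : StateSpaceModel n m) (ω : ℝ) : Matrix (Fin m) (Fin m) ℂ :=
  (M.transfer (Complex.exp (ω * Complex.I)))ᴴ + M.transfer (Complex.exp (ω * Complex.I))

/-- `Φ(e^{iω})` is defined and positive definite for all `ω ∈ [-π, π]`. -/
def IsStrictlyPositiveReal (M : StateSpaceModel n m) : Prop :=
  ∀ ω ∈ Set.Icc (-Real.pi) Real.pi,
    Complex.exp (ω * Complex.I) ∉ spectrum ℂ M.A ∧ (M.Phi ω).PosDef

/-- `Φ(e^{iω})` is positive semidefinite for all `ω ∈ [-π, π]` at which it is defined, i.e.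
at which `e^{iω}` is not an eigenvalue of `A` (a stable `A` may have unimodular eigenvalues). -/
def IsPositiveReal (M : StateSpaceModel n m) : Prop :=
  ∀ ω ∈ Set.Icc (-Real.pi) Real.pi,
    Complex.exp (ω * Complex.I) ∉ spectrum ℂ M.A → (M.Phi ω).PosSemidef

/-- All eigenvalues of `A` lie in the open unit disc. -/
def IsAsymptoticallyStable (M : StateSpaceModel n m) : Prop :=
  ∀ μ ∈ spectrum ℂ M.A, ‖μ‖ < 1

/-- All eigenvalues of `A` lie in the closed unit disc, and those on the unit circle are
semisimple (every generalized eigenvector is an eigenvector). -/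
def IsStable (M : StateSpaceModel n m) : Prop :=
  ∀ μ ∈ spectrum ℂ M.A, ‖μ‖ ≤ 1 ∧
    (‖μ‖ = 1 → Module.End.maxGenEigenspace (Matrix.toLin' M.A) μ =
      Module.End.eigenspace (Matrix.toLin' M.A) μ)

def IsStrictlyPassive (M : StateSpaceModel n m) : Prop :=
  M.IsStrictlyPositiveReal ∧ M.IsAsymptoticallyStable

def IsPassive (M : StateSpaceModel n m) : Prop :=
  M.IsPositiveReal ∧ M.IsStable

/-- The matrix `W(X, M)`. -/
def W (M : StateSpaceModel n m) (X : Matrix (Fin n) (Fin n) ℂ) :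
    Matrix (Fin n ⊕ Fin m) (Fin n ⊕ Fin m) ℂ :=
  fromBlocks (X - M.Aᴴ * X * M.A) (M.Cᴴ - M.Aᴴ * X * M.B)
    (M.C - M.Bᴴ * X * M.A) (M.Dᴴ + M.D - M.Bᴴ * X * M.B)

/-- The set of Hermitian `X > 0` with `W(X, M) ≥ 0`. -/
def solutionSet (M : StateSpaceModel n m) : Set (Matrix (Fin n) (Fin n) ℂ) :=
  {X | (M.W X).PosSemidef ∧ X.PosDef}

/-- The matrix `W̃(X, M) = [X, XA, XB; AᴴX, X, Cᴴ; BᴴX, C, Dᴴ + D]`. -/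
def Wtilde (M : StateSpaceModel n m) (X : Matrix (Fin n) (Fin n) ℂ) :
    Matrix ((Fin n ⊕ Fin n) ⊕ Fin m) ((Fin n ⊕ Fin n) ⊕ Fin m) ℂ :=
  fromBlocks
    (fromBlocks X (X * M.A) (M.Aᴴ * X) X) (fromRows (X * M.B) M.Cᴴ)
    (fromCols (M.Bᴴ * X) M.C) (M.Dᴴ + M.D)

/-- The set of Hermitian `X > 0` with `W̃(X, M) ≥ 0`. -/
def wtildeSet (M : StateSpaceModel n m) : Set (Matrix (Fin n) (Fin n) ℂ) :=
  {X | X.PosDef ∧ (M.Wtilde X).PosSemidef}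

/-- The set of Hermitian `X > 0` with `W̃(X, M) > 0`. -/
def wtildeStrictSet (M : StateSpaceModel n m) : Set (Matrix (Fin n) (Fin n) ℂ) :=
  {X | X.PosDef ∧ (M.Wtilde X).PosDef}

/-- The modified model `M_ξ = {A/(1-ξ), B/(1-ξ), C/(1-ξ), (D - ξI)/(1-ξ)}` (used for `ξ < 1`). -/
def shift (M : StateSpaceModel n m) (ξ : ℝ) : StateSpaceModel n m where
  A := ((1 - ξ : ℝ) : ℂ)⁻¹ • M.A
  B := ((1 - ξ : ℝ) : ℂ)⁻¹ • M.B
  C := ((1 - ξ : ℝ) : ℂ)⁻¹ • M.C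
  D := ((1 - ξ : ℝ) : ℂ)⁻¹ • (M.D - (ξ : ℂ) • (1 : Matrix (Fin m) (Fin m) ℂ))

/-- The block diagonal matrix `diag(X, X, 2 I_m)`. -/
def weight (m : ℕ) (X : Matrix (Fin n) (Fin n) ℂ) :
    Matrix ((Fin n ⊕ Fin n) ⊕ Fin m) ((Fin n ⊕ Fin n) ⊕ Fin m) ℂ :=
  fromBlocks (fromBlocks X 0 0 X) 0 0 ((2 : ℂ) • (1 : Matrix (Fin m) (Fin m) ℂ))

/-- The real `ξ` with `W̃(X, M) ≥ ξ diag(X, X, 2 I_m)`. -/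
def xiFeasible (M : StateSpaceModel n m) (X : Matrix (Fin n) (Fin n) ℂ) : Set ℝ :=
  {ξ | (M.Wtilde X - (ξ : ℂ) • weight m X).PosSemidef}

/-- `ξ*(X)`, the maximal `ξ` with `W̃(X, M) ≥ ξ diag(X, X, 2 I_m)`. -/
def xiStar (M : StateSpaceModel n m) (X : Matrix (Fin n) (Fin n) ℂ) : ℝ :=
  sSup (M.xiFeasible X)

end StateSpaceModel

end

/-! ### Controllability and invariant subspaces -/

noncomputable section

/-! Call `X > 0` with `W̃(X, M) ≥ 0` a certificate of `M`. By `Wtilde_sub_smul_weight`, for `ξ < 1`,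
`X > 0` certifies `M_ξ` exactly when `ξ` is feasible for `X`, so the theorem is about maximizing `ξ`
over feasible pairs `(ξ, X)`. Minimality makes the certificates of `M` a compact set
(`isCompact_wtildeSet`): controllability bounds `X`, and observability bounds `X⁻¹` through the dual
model. Hence a maximizing pair `(Ξ, X)` exists, and controllability rules out `Ξ = 1`. Since the
weight is positive definite, this `X` is a strict certificate of `M_ξ` for each `ξ < Ξ`, while a
strict certificate at `Ξ` would leave room to increase `Ξ`.

Certificates are tied to transfer functions by evaluating `W̃` on vectors with `A x + B u = l x`,
`|l| = 1`: this shows that (strict) certificates give (strict) passivity. The converse needed for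
the upper bound is the strict Kalman–Yakubovich–Popov lemma, proved by Hahn–Banach: an obstruction
would be a nonzero `Z ≥ 0` that splits into rank-one terms supported on such frequency vectors
(`PosSemidef.exists_eq_sum_vecMulVec`), contradicting `Φ > 0`. -/

theorem IsControllablePair.submodule_eq_top {n m : ℕ} {A : Matrix (Fin n) (Fin n) ℂ}
    {B : Matrix (Fin n) (Fin m) ℂ} (h : IsControllablePair A B)
    (S : Submodule ℂ (Fin n → ℂ)) (hA : ∀ x ∈ S, A *ᵥ x ∈ S) (hB : ∀ u, B *ᵥ u ∈ S) :
    S = ⊤ := by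
  by_contra hS
  have : Nontrivial ((Fin n → ℂ) ⧸ S) := Submodule.Quotient.nontrivial_iff.2 hS
  -- Hautus argument: `A` has an eigenvalue `z` on the nonzero quotient, but full rank of `[zI - A,
  -- B]` makes `zI - A` surjective, hence injective, modulo `S`.
  let T : Module.End ℂ ((Fin n → ℂ) ⧸ S) := S.mapQ S A.mulVecLin hA
  obtain ⟨z, hz⟩ := Module.End.exists_eigenvalue T
  obtain ⟨v, hv⟩ := hz.exists_hasEigenvector
  let Q : Module.End ℂ ((Fin n → ℂ) ⧸ S) := z • LinearMap.id - T
  have hsurj : Function.Surjective Q := by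
    intro y
    obtain ⟨y, rfl⟩ := Submodule.Quotient.mk_surjective S y
    have htop : LinearMap.range
        (fromCols (z • (1 : Matrix (Fin n) (Fin n) ℂ) - A) B).mulVecLin = ⊤ := by
      apply Submodule.eq_top_of_finrank_eq
      have := h z
      rw [Matrix.rank] at this
      rw [this]; simp
    obtain ⟨w, hw⟩ := LinearMap.range_eq_top.1 htop y
    refine ⟨Submodule.Quotient.mk (w ∘ Sum.inl), ?_⟩
    rw [mulVecLin_apply, fromCols_mulVec] at hw
    have : Q (Submodule.Quotient.mk (w ∘ Sum.inl)) =
        Submodule.Quotient.mk ((z • (1 : Matrix (Fin n) (Fin n) ℂ) - A) *ᵥ (w ∘ Sum.inl)) := by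
      simp only [Q, T, sub_mulVec, smul_mulVec, one_mulVec, LinearMap.sub_apply,
        LinearMap.smul_apply, LinearMap.id_apply, Submodule.Quotient.mk_sub,
        Submodule.Quotient.mk_smul]
      rfl
    rw [this, Submodule.Quotient.eq, ← hw, sub_add_cancel_left]
    exact S.neg_mem (hB _)
  have hinj := LinearMap.injective_iff_surjective.2 hsurj
  refine hv.2 (hinj ?_)
  have := hv.apply_eq_smul
  simp [Q, this]

/-! ### Positive semidefinite matrices: entry bounds and closedness -/

namespace Matrix

variable {ι κ : Type*} [Fintype ι] [Fintype κ]

theorem star_mulVec_dotProduct (A : Matrix κ ι ℂ) (x : ι → ℂ) (y : κ → ℂ) :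
    star (A *ᵥ x) ⬝ᵥ y = star x ⬝ᵥ (Aᴴ *ᵥ y) := by
  rw [star_mulVec, dotProduct_mulVec]

theorem star_dotProduct_comm (x y : ι → ℂ) : star x ⬝ᵥ y = star (star y ⬝ᵥ x) := by
  rw [← star_dotProduct_star, star_star, dotProduct_comm]

open scoped MatrixOrder in
theorem PosSemidef.exists_eq_conjTranspose_mul_self [DecidableEq ι] {Z : Matrix ι ι ℂ}
    (hZ : Z.PosSemidef) : ∃ V : Matrix ι ι ℂ, Z = Vᴴ * V :=
  CStarAlgebra.nonneg_iff_eq_star_mul_self.mp hZ.nonneg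

theorem PosSemidef.norm_apply_le [DecidableEq ι] {Z : Matrix ι ι ℂ} (hZ : Z.PosSemidef)
    (i j : ι) : ‖Z i j‖ ≤ ((Z i i).re + (Z j j).re) / 2 := by
  obtain ⟨V, rfl⟩ := hZ.exists_eq_conjTranspose_mul_self
  have hd (k : ι) : ((Vᴴ * V) k k).re = ∑ l, ‖V l k‖ ^ 2 := by
    simp [mul_apply, Complex.mul_re, Complex.sq_norm, Complex.normSq_apply]
  rw [hd, hd, ← Finset.sum_add_distrib, Finset.sum_div, mul_apply]
  refine norm_sum_le_of_le _ fun l _ => ?_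
  rw [norm_mul, conjTranspose_apply, norm_star]
  nlinarith [sq_nonneg (‖V l i‖ - ‖V l j‖)]

theorem isClosed_setOf_posSemidef : IsClosed {Z : Matrix ι ι ℂ | Z.PosSemidef} := by
  simp only [posSemidef_iff_dotProduct_mulVec, Set.ofPred_and, Set.ofPred_forall]
  refine IsClosed.inter ?_ (isClosed_iInter fun x => ?_)
  · exact isClosed_eq (by fun_prop) continuous_id
  · exact isClosed_le continuous_const (by fun_prop)

omit [Fintype ι] [Fintype κ] in
theorem isCompact_setOf_norm_apply_le (c : ℝ) :
    IsCompact {Z : Matrix ι κ ℂ | ∀ i j, ‖Z i j‖ ≤ c} := by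
  have : {Z : Matrix ι κ ℂ | ∀ i j, ‖Z i j‖ ≤ c} =
      Set.univ.pi fun _ => Set.univ.pi fun _ => Metric.closedBall (0 : ℂ) c := by
    ext Z
    change _ ↔ ∀ i ∈ Set.univ, ∀ j ∈ Set.univ, Z i j ∈ Metric.closedBall (0 : ℂ) c
    simp
  rw [this]
  exact isCompact_univ_pi fun _ => isCompact_univ_pi fun _ => isCompact_closedBall _ _

end Matrix

/-! ### The sesquilinear form of `W̃` -/

namespace StateSpaceModel

variable {n m : ℕ}

theorem star_dotProduct_Wtilde_mulVec (M : StateSpaceModel n m) (X : Matrix (Fin n) (Fin n) ℂ)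
    (w x : Fin n → ℂ) (u : Fin m → ℂ) :
    star (Sum.elim (Sum.elim w x) u) ⬝ᵥ (M.Wtilde X *ᵥ Sum.elim (Sum.elim w x) u) =
      star w ⬝ᵥ (X *ᵥ w) + star w ⬝ᵥ (X *ᵥ (M.A *ᵥ x + M.B *ᵥ u)) +
      star (M.A *ᵥ x + M.B *ᵥ u) ⬝ᵥ (X *ᵥ w) + star x ⬝ᵥ (X *ᵥ x) +
      star u ⬝ᵥ (M.C *ᵥ x + M.D *ᵥ u) + star (M.C *ᵥ x + M.D *ᵥ u) ⬝ᵥ u := by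
  have hs : star (Sum.elim (Sum.elim w x) u) = Sum.elim (Sum.elim (star w) (star x)) (star u) := by
    ext ((i | i) | i) <;> rfl
  rw [hs, Wtilde]
  have h1 : (X * M.A) *ᵥ x + (X * M.B) *ᵥ u = X *ᵥ (M.A *ᵥ x + M.B *ᵥ u) := by
    simp only [mulVec_add, mulVec_mulVec]
  have h2 : star x ⬝ᵥ ((M.Aᴴ * X) *ᵥ w) + star u ⬝ᵥ ((M.Bᴴ * X) *ᵥ w) =
      star (M.A *ᵥ x + M.B *ᵥ u) ⬝ᵥ (X *ᵥ w) := by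
    simp only [star_add, add_dotProduct, star_mulVec_dotProduct, mulVec_mulVec]
  have h3 : star x ⬝ᵥ (M.Cᴴ *ᵥ u) + star u ⬝ᵥ (M.Dᴴ *ᵥ u) =
      star (M.C *ᵥ x + M.D *ᵥ u) ⬝ᵥ u := by
    simp only [star_add, add_dotProduct, star_mulVec_dotProduct]
  rw [← h1, ← h2, ← h3]
  simp only [fromBlocks_mulVec, fromRows_mulVec, fromCols_mulVec, sumElim_dotProduct_sumElim,
    Sum.elim_comp_inl, Sum.elim_comp_inr, dotProduct_add, add_mulVec,
    ← Sum.elim_add_add]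
  ring

end StateSpaceModel

/-! ### Real quadratic forms -/

namespace Matrix

variable {ι κ : Type*} [Fintype ι] [Fintype κ]

/-- The real part of the sesquilinear form `xᴴ X x`. -/
def quadRe (X : Matrix ι ι ℂ) (x : ι → ℂ) : ℝ := (star x ⬝ᵥ (X *ᵥ x)).re

theorem IsHermitian.ofReal_quadRe {X : Matrix ι ι ℂ} (hX : X.IsHermitian) (x : ι → ℂ) :
    (X.quadRe x : ℂ) = star x ⬝ᵥ (X *ᵥ x) := by
  rw [quadRe, ← Complex.conj_eq_iff_re, starRingEnd_apply]
  conv_rhs => rw [star_dotProduct_comm, star_mulVec_dotProduct, hX.eq]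

theorem posSemidef_iff_quadRe {X : Matrix ι ι ℂ} :
    X.PosSemidef ↔ X.IsHermitian ∧ ∀ x, 0 ≤ X.quadRe x := by
  rw [posSemidef_iff_dotProduct_mulVec]
  refine and_congr_right fun hX => forall_congr' fun x => ?_
  rw [← hX.ofReal_quadRe]
  exact_mod_cast Iff.rfl

theorem posDef_iff_quadRe {X : Matrix ι ι ℂ} :
    X.PosDef ↔ X.IsHermitian ∧ ∀ x, x ≠ 0 → 0 < X.quadRe x := by
  rw [posDef_iff_dotProduct_mulVec]
  refine and_congr_right fun hX => forall_congr' fun x => imp_congr_right fun _ => ?_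
  rw [← hX.ofReal_quadRe]
  exact_mod_cast Iff.rfl

theorem PosSemidef.quadRe_nonneg {X : Matrix ι ι ℂ} (hX : X.PosSemidef) (x : ι → ℂ) :
    0 ≤ X.quadRe x := (posSemidef_iff_quadRe.1 hX).2 x

theorem PosDef.quadRe_pos {X : Matrix ι ι ℂ} (hX : X.PosDef) {x : ι → ℂ} (hx : x ≠ 0) :
    0 < X.quadRe x := (posDef_iff_quadRe.1 hX).2 x hx

theorem PosDef.eq_zero_of_quadRe_nonpos {X : Matrix ι ι ℂ} (hX : X.PosDef) {x : ι → ℂ}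
    (hx : X.quadRe x ≤ 0) : x = 0 := by
  by_contra h
  exact (hX.quadRe_pos h).not_ge hx

@[simp]
theorem quadRe_zero_right (X : Matrix ι ι ℂ) : X.quadRe 0 = 0 := by simp [quadRe]

theorem quadRe_smul (X : Matrix ι ι ℂ) (a : ℂ) (x : ι → ℂ) :
    X.quadRe (a • x) = ‖a‖ ^ 2 * X.quadRe x := by
  have h : star (a • x) ⬝ᵥ (X *ᵥ (a • x)) = ((‖a‖ ^ 2 : ℝ) : ℂ) * (star x ⬝ᵥ (X *ᵥ x)) := by
    rw [star_smul, mulVec_smul, smul_dotProduct, dotProduct_smul, smul_eq_mul, smul_eq_mul,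
      ← mul_assoc]
    congr 1
    push_cast
    exact Complex.conj_mul' a
  rw [quadRe, h, Complex.re_ofReal_mul, quadRe]

theorem quadRe_add_add_quadRe_sub (X : Matrix ι ι ℂ) (x y : ι → ℂ) :
    X.quadRe (x + y) + X.quadRe (x - y) = 2 * (X.quadRe x + X.quadRe y) := by
  simp only [quadRe, star_add, star_sub, mulVec_add, mulVec_sub, add_dotProduct, sub_dotProduct,
    dotProduct_add, dotProduct_sub, Complex.add_re, Complex.sub_re]
  ring

theorem IsHermitian.quadRe_add {X : Matrix ι ι ℂ} (hX : X.IsHermitian) (x y : ι → ℂ) :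
    X.quadRe (x + y) = X.quadRe x + 2 * (star x ⬝ᵥ (X *ᵥ y)).re + X.quadRe y := by
  have : (star y ⬝ᵥ (X *ᵥ x)).re = (star x ⬝ᵥ (X *ᵥ y)).re := by
    rw [star_dotProduct_comm, star_mulVec_dotProduct, hX.eq, Complex.star_def, Complex.conj_re]
  simp only [quadRe, star_add, mulVec_add, add_dotProduct, dotProduct_add, Complex.add_re, this]
  ring

theorem quadRe_add_left (X Y : Matrix ι ι ℂ) (x : ι → ℂ) :
    (X + Y).quadRe x = X.quadRe x + Y.quadRe x := by
  simp [quadRe, add_mulVec]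

theorem quadRe_sub_left (X Y : Matrix ι ι ℂ) (x : ι → ℂ) :
    (X - Y).quadRe x = X.quadRe x - Y.quadRe x := by
  simp [quadRe, sub_mulVec]

theorem quadRe_smul_left (c : ℝ) (X : Matrix ι ι ℂ) (x : ι → ℂ) :
    ((c : ℂ) • X).quadRe x = c * X.quadRe x := by
  simp [quadRe, smul_mulVec]

theorem quadRe_single [DecidableEq ι] (X : Matrix ι ι ℂ) (i : ι) :
    X.quadRe (Pi.single i 1) = (X i i).re := by
  simp [quadRe]

theorem quadRe_conjTranspose_mul_mul (X : Matrix ι ι ℂ) (A : Matrix ι κ ℂ) (x : κ → ℂ) :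
    (Aᴴ * X * A).quadRe x = X.quadRe (A *ᵥ x) := by
  rw [quadRe, quadRe, star_mulVec_dotProduct, mulVec_mulVec, mulVec_mulVec, Matrix.mul_assoc]

end Matrix

/-! ### Compactness of the set of certificates -/

namespace StateSpaceModel

variable {n m : ℕ}

theorem quadRe_Wtilde (M : StateSpaceModel n m) {X : Matrix (Fin n) (Fin n) ℂ}
    (hX : X.IsHermitian) (w x : Fin n → ℂ) (u : Fin m → ℂ) :
    (M.Wtilde X).quadRe (Sum.elim (Sum.elim w x) u) =
      X.quadRe w + 2 * (star w ⬝ᵥ (X *ᵥ (M.A *ᵥ x + M.B *ᵥ u))).re + X.quadRe x +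
      2 * (star u ⬝ᵥ (M.C *ᵥ x + M.D *ᵥ u)).re := by
  have h1 : (star (M.A *ᵥ x + M.B *ᵥ u) ⬝ᵥ (X *ᵥ w)).re =
      (star w ⬝ᵥ (X *ᵥ (M.A *ᵥ x + M.B *ᵥ u))).re := by
    rw [star_dotProduct_comm, star_mulVec_dotProduct, hX.eq, Complex.star_def, Complex.conj_re]
  have h2 : (star (M.C *ᵥ x + M.D *ᵥ u) ⬝ᵥ u).re = (star u ⬝ᵥ (M.C *ᵥ x + M.D *ᵥ u)).re := by
    rw [star_dotProduct_comm, Complex.star_def, Complex.conj_re]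
  rw [quadRe, star_dotProduct_Wtilde_mulVec]
  simp only [Complex.add_re, h1, h2, quadRe]
  ring

theorem isHermitian_Wtilde (M : StateSpaceModel n m) {X : Matrix (Fin n) (Fin n) ℂ}
    (hX : X.IsHermitian) : (M.Wtilde X).IsHermitian := by
  refine IsHermitian.fromBlocks (IsHermitian.fromBlocks hX ?_ hX) ?_ ?_
  · rw [conjTranspose_mul, hX.eq]
  · rw [conjTranspose_fromRows_eq_fromCols_conjTranspose, conjTranspose_mul, hX.eq,
      conjTranspose_conjTranspose]
  · rw [IsHermitian, conjTranspose_add, conjTranspose_conjTranspose, add_comm]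

/-- The dual model `{Aᴴ, Cᴴ, Bᴴ, Dᴴ}`. -/
def dual (M : StateSpaceModel n m) : StateSpaceModel n m := ⟨M.Aᴴ, M.Cᴴ, M.Bᴴ, M.Dᴴ⟩

/-- A congruence: the dual form for `X⁻¹` at `(Xw, Xx, u)` equals the original form for `X` at `(x,
w, u)`, with the two state blocks swapped. -/
theorem inv_mem_wtildeSet_dual {M : StateSpaceModel n m} {X : Matrix (Fin n) (Fin n) ℂ}
    (h : X ∈ M.wtildeSet) : X⁻¹ ∈ M.dual.wtildeSet := by
  obtain ⟨hX, hW⟩ := h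
  refine ⟨hX.inv, posSemidef_iff_dotProduct_mulVec.2 ⟨isHermitian_Wtilde _ hX.inv.1, fun v => ?_⟩⟩
  have hdet := (Matrix.isUnit_iff_isUnit_det _).1 hX.isUnit
  have hinv (x : Fin n → ℂ) : ∃ y, x = X *ᵥ y :=
    ⟨X⁻¹ *ᵥ x, by rw [mulVec_mulVec, mul_nonsing_inv _ hdet, one_mulVec]⟩
  have hinv' (y : Fin n → ℂ) : X⁻¹ *ᵥ (X *ᵥ y) = y := by
    rw [mulVec_mulVec, nonsing_inv_mul _ hdet, one_mulVec]
  obtain ⟨w, hw⟩ := hinv (fun i => v (Sum.inl (Sum.inl i)))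
  obtain ⟨x, hx⟩ := hinv (fun i => v (Sum.inl (Sum.inr i)))
  obtain ⟨u, rfl⟩ : ∃ u, v = Sum.elim (Sum.elim (X *ᵥ w) (X *ᵥ x)) u := by
    refine ⟨fun i => v (Sum.inr i), ?_⟩
    rw [← hw, ← hx]; ext ((i | i) | i) <;> rfl
  have := hW.dotProduct_mulVec_nonneg (Sum.elim (Sum.elim x w) u)
  rw [star_dotProduct_Wtilde_mulVec] at this ⊢
  refine this.trans_eq ?_
  have hs (a b : Fin n → ℂ) : star (X *ᵥ a) ⬝ᵥ b = star a ⬝ᵥ (X *ᵥ b) := by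
    rw [star_mulVec_dotProduct, hX.1.eq]
  have hXX (y : Fin n → ℂ) : X *ᵥ (X⁻¹ *ᵥ y) = y := by
    rw [mulVec_mulVec, mul_nonsing_inv _ hdet, one_mulVec]
  simp only [dual, hinv', hs, hXX, mulVec_add, dotProduct_add, star_add, add_dotProduct,
    star_mulVec_dotProduct, conjTranspose_conjTranspose]
  ring

theorem quadRe_A_mulVec_le {M : StateSpaceModel n m} {X : Matrix (Fin n) (Fin n) ℂ}
    (hX : X.IsHermitian) (hW : (M.Wtilde X).PosSemidef) (x : Fin n → ℂ) :
    X.quadRe (M.A *ᵥ x) ≤ X.quadRe x := by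
  -- `w = -A x` minimizes the form over `w`, i.e. takes the Schur complement of the leading block.
  have := hW.quadRe_nonneg (Sum.elim (Sum.elim (-(M.A *ᵥ x)) x) 0)
  rw [quadRe_Wtilde _ hX] at this
  simp [quadRe, mulVec_neg] at this ⊢
  linarith

theorem quadRe_B_mulVec_le {M : StateSpaceModel n m} {X : Matrix (Fin n) (Fin n) ℂ}
    (hX : X.IsHermitian) (hW : (M.Wtilde X).PosSemidef) (u : Fin m → ℂ) :
    X.quadRe (M.B *ᵥ u) ≤ 2 * (star u ⬝ᵥ (M.D *ᵥ u)).re := by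
  have := hW.quadRe_nonneg (Sum.elim (Sum.elim (-(M.B *ᵥ u)) 0) u)
  rw [quadRe_Wtilde _ hX] at this
  simp [quadRe, mulVec_neg] at this ⊢
  linarith

/-- The vectors whose energy `xᴴ X x` is bounded uniformly over all certificates form a subspace
that contains the range of `B` and is `A`-invariant, hence is everything. Bounded diagonals then
bound all entries. -/
theorem exists_norm_apply_le_of_mem_wtildeSet {M : StateSpaceModel n m}
    (hc : IsControllablePair M.A M.B) :
    ∃ c, ∀ X ∈ M.wtildeSet, ∀ i j, ‖X i j‖ ≤ c := by
  let S : Submodule ℂ (Fin n → ℂ) :=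
    { carrier := {x | ∃ c, ∀ X ∈ M.wtildeSet, X.quadRe x ≤ c}
      zero_mem' := ⟨0, by simp⟩
      add_mem' := by
        rintro x y ⟨c, hc⟩ ⟨d, hd⟩
        refine ⟨2 * (c + d), fun X hX => ?_⟩
        have := quadRe_add_add_quadRe_sub X x y
        have := hX.1.posSemidef.quadRe_nonneg (x - y)
        have := hc X hX
        have := hd X hX
        linarith
      smul_mem' := by
        rintro a x ⟨c, hc⟩
        refine ⟨‖a‖ ^ 2 * c, fun X hX => ?_⟩
        rw [quadRe_smul]
        exact mul_le_mul_of_nonneg_left (hc X hX) (by positivity) }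
  have hS : S = ⊤ := hc.submodule_eq_top S
    (fun x ⟨c, hc⟩ => ⟨c, fun X hX => (quadRe_A_mulVec_le hX.1.1 hX.2 x).trans (hc X hX)⟩)
    (fun u => ⟨_, fun X hX => quadRe_B_mulVec_le hX.1.1 hX.2 u⟩)
  have hmem (i : Fin n) : ∃ c, ∀ X ∈ M.wtildeSet, (X i i).re ≤ c := by
    obtain ⟨c, hc⟩ : (Pi.single i 1 : Fin n → ℂ) ∈ S := hS ▸ Submodule.mem_top
    exact ⟨c, fun X hX => quadRe_single X i ▸ hc X hX⟩
  choose c hc using hmem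
  refine ⟨∑ i, |c i|, fun X hX i j => (hX.1.posSemidef.norm_apply_le i j).trans ?_⟩
  have hle (k : Fin n) : (X k k).re ≤ ∑ i, |c i| :=
    (hc k X hX).trans <| (le_abs_self _).trans <|
      Finset.single_le_sum (f := fun i => |c i|) (fun _ _ => abs_nonneg _) (Finset.mem_univ k)
  linarith [hle i, hle j]

theorem continuous_Wtilde (M : StateSpaceModel n m) : Continuous M.Wtilde := by
  unfold Wtilde
  have h1 : Continuous fun X : Matrix (Fin n) (Fin n) ℂ => fromRows (X * M.B) M.Cᴴ := by
    refine continuous_pi fun i => continuous_pi fun j => ?_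
    rcases i with i | i
    · exact Continuous.matrix_elem (by fun_prop : Continuous fun X => X * M.B) i j
    · exact continuous_const
  have h2 : Continuous fun X : Matrix (Fin n) (Fin n) ℂ => fromCols (M.Bᴴ * X) M.C := by
    refine continuous_pi fun i => continuous_pi fun j => ?_
    rcases j with j | j
    · exact Continuous.matrix_elem (by fun_prop : Continuous fun X => M.Bᴴ * X) i j
    · exact continuous_const
  exact ((continuous_id.matrix_fromBlocks (by fun_prop) (by fun_prop) continuous_id)).matrix_fromBlocks
    h1 h2 continuous_const

theorem isCompact_wtildeSet {M : StateSpaceModel n m} (hM : M.IsMinimal) :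
    IsCompact M.wtildeSet := by
  obtain ⟨c, hc⟩ := exists_norm_apply_le_of_mem_wtildeSet hM.1
  obtain ⟨d, hd⟩ := exists_norm_apply_le_of_mem_wtildeSet (M := M.dual) hM.2
  -- `X > 0` is not a closed condition; recording a bounded inverse `Y` with `X Y = 1` makes it one.
  have hK : IsCompact (({X : Matrix (Fin n) (Fin n) ℂ | ∀ i j, ‖X i j‖ ≤ c} ×ˢ
      {Y : Matrix (Fin n) (Fin n) ℂ | ∀ i j, ‖Y i j‖ ≤ d}) ∩
      {p | p.1.PosSemidef ∧ p.1 * p.2 = 1 ∧ (M.Wtilde p.1).PosSemidef}) := by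
    refine ((isCompact_setOf_norm_apply_le c).prod (isCompact_setOf_norm_apply_le d)).inter_right ?_
    refine (isClosed_setOf_posSemidef.preimage continuous_fst).inter (IsClosed.inter ?_ ?_)
    · exact isClosed_eq (by fun_prop) continuous_const
    · exact isClosed_setOf_posSemidef.preimage (M.continuous_Wtilde.comp continuous_fst)
  convert hK.image continuous_fst using 1
  ext X
  constructor
  · intro hX
    exact ⟨(X, X⁻¹), ⟨⟨hc X hX, hd _ (inv_mem_wtildeSet_dual hX)⟩, hX.1.posSemidef,
      mul_nonsing_inv _ ((Matrix.isUnit_iff_isUnit_det _).1 hX.1.isUnit), hX.2⟩, rfl⟩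
  · rintro ⟨⟨X, Y⟩, ⟨-, hX, hXY, hW⟩, rfl⟩
    exact ⟨hX.posDef_iff_isUnit.2 (IsUnit.of_mul_eq_one _ hXY), hW⟩

end StateSpaceModel

/-! ### Splitting a positive semidefinite matrix along frequency vectors -/

namespace Matrix

/-- Two matrices with equal Gram matrices `P Pᴴ = Q Qᴴ` differ by an isometry. -/
theorem exists_linearIsometry_of_mul_conjTranspose_eq {ι κ : Type*} [Fintype ι] [Fintype κ]
    {P Q : Matrix ι κ ℂ} (h : P * Pᴴ = Q * Qᴴ) :
    ∃ U : EuclideanSpace ℂ κ →ₗᵢ[ℂ] EuclideanSpace ℂ κ,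
      ∀ x, U (WithLp.toLp 2 (Pᴴ *ᵥ x)) = WithLp.toLp 2 (Qᴴ *ᵥ x) := by
  let p : (ι → ℂ) →ₗ[ℂ] EuclideanSpace ℂ κ :=
    (WithLp.linearEquiv 2 ℂ (κ → ℂ)).symm.toLinearMap ∘ₗ Pᴴ.mulVecLin
  let q : (ι → ℂ) →ₗ[ℂ] EuclideanSpace ℂ κ :=
    (WithLp.linearEquiv 2 ℂ (κ → ℂ)).symm.toLinearMap ∘ₗ Qᴴ.mulVecLin
  have hnorm (R : Matrix ι κ ℂ) (x : ι → ℂ) :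
      ‖WithLp.toLp 2 (Rᴴ *ᵥ x)‖ ^ 2 = (R * Rᴴ).quadRe x := by
    rw [← inner_self_eq_norm_sq (𝕜 := ℂ), EuclideanSpace.inner_toLp_toLp, dotProduct_comm,
      star_mulVec_dotProduct, conjTranspose_conjTranspose, mulVec_mulVec]
    rfl
  have hpq (x : ι → ℂ) : ‖q x‖ = ‖p x‖ := by
    rw [← sq_eq_sq₀ (norm_nonneg _) (norm_nonneg _)]
    exact (hnorm Q x).trans (h ▸ (hnorm P x).symm)
  have hker : LinearMap.ker p ≤ LinearMap.ker q := by
    intro x hx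
    rw [LinearMap.mem_ker, ← norm_eq_zero] at hx ⊢
    rw [hpq, hx]
  let L0 : LinearMap.range p →ₗ[ℂ] EuclideanSpace ℂ κ :=
    (LinearMap.ker p).liftQ q hker ∘ₗ p.quotKerEquivRange.symm.toLinearMap
  have hL0 (x : ι → ℂ) : L0 ⟨p x, LinearMap.mem_range_self p x⟩ = q x := by
    have : p.quotKerEquivRange.symm ⟨p x, LinearMap.mem_range_self p x⟩ =
        Submodule.Quotient.mk x := by
      rw [LinearEquiv.symm_apply_eq]; rfl
    simp [L0, this]
  let L : LinearMap.range p →ₗᵢ[ℂ] EuclideanSpace ℂ κ :=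
    { L0 with
      norm_map' := by
        rintro ⟨_, x, rfl⟩
        exact (congrArg norm (hL0 x)).trans (hpq x) }
  exact ⟨L.extend, fun x =>
    (L.extend_apply ⟨p x, LinearMap.mem_range_self p x⟩).trans (hL0 x)⟩

/-- In finite dimension the isometry `T` is unitary, so `T + T*` and `i(T - T*)` are commuting
symmetric operators; a joint eigenbasis diagonalizes `T`. -/
theorem _root_.LinearIsometry.exists_orthonormalBasis_eigenvectors {E : Type*}
    [NormedAddCommGroup E] [InnerProductSpace ℂ E] [FiniteDimensional ℂ E] (U : E →ₗᵢ[ℂ] E) :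
    ∃ (b : OrthonormalBasis (Fin (Module.finrank ℂ E)) ℂ E) (l : Fin (Module.finrank ℂ E) → ℂ),
      ∀ i, U (b i) = l i • b i := by
  let T : E →ₗ[ℂ] E := U.toLinearMap
  let T' := T.adjoint
  have h1 : T' * T = 1 := by
    ext x
    refine ext_inner_right ℂ fun y => ?_
    simp [T', T, LinearMap.adjoint_inner_left]
  have h2 : T * T' = 1 := mul_eq_one_comm.1 h1
  have hA : (T + T').IsSymmetric := by
    intro x y
    simp [T', LinearMap.adjoint_inner_left, LinearMap.adjoint_inner_right, inner_add_left,
      inner_add_right, add_comm]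
  have hB : (Complex.I • (T - T')).IsSymmetric := by
    intro x y
    simp [T', LinearMap.adjoint_inner_left, LinearMap.adjoint_inner_right, inner_sub_left,
      inner_sub_right, inner_smul_left, inner_smul_right]
    ring
  have hAB : Commute (T + T') (Complex.I • (T - T')) := by
    refine Commute.smul_right ?_ _
    rw [commute_iff_eq]
    simp only [mul_sub, add_mul, sub_mul, mul_add, h1, h2]
    abel
  have hint := hA.directSum_isInternal_of_commute hB hAB
  have hort := LinearMap.IsSymmetric.orthogonalFamily_eigenspace_inf_eigenspace hA hB
  classical
  have := hint.submodule_iSupIndep.fintypeNeBotOfFiniteDimensional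
  replace hint := DirectSum.isInternal_ne_bot_iff.2 hint
  replace hort := hort.comp (γ := {i // Module.End.eigenspace (T + T') (i : ℂ × ℂ).2 ⊓
    Module.End.eigenspace (Complex.I • (T - T')) i.1 ≠ ⊥}) Subtype.val_injective
  suffices h : ∀ i, ∃ l : ℂ, U (hint.subordinateOrthonormalBasis rfl hort i) =
      l • hint.subordinateOrthonormalBasis rfl hort i by
    choose l hl using h
    exact ⟨_, l, hl⟩
  intro i
  obtain ⟨h1, h2⟩ := hint.subordinateOrthonormalBasis_subordinate rfl i hort
  generalize hint.subordinateOrthonormalBasis rfl hort i = v at h1 h2 ⊢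
  generalize hint.subordinateOrthonormalBasisIndex rfl i hort = k at h1 h2 ⊢
  replace h1 := Module.End.mem_eigenspace_iff.1 h1
  replace h2 := Module.End.mem_eigenspace_iff.1 h2
  have h3 : U v = (2⁻¹ : ℂ) • ((T + T') v - Complex.I • (Complex.I • (T - T')) v) := by
    simp only [LinearMap.add_apply, LinearMap.smul_apply, LinearMap.sub_apply, smul_smul,
      Complex.I_mul_I, T, LinearIsometry.coe_toLinearMap]
    module
  refine ⟨(k.1.2 - Complex.I * k.1.1) / 2, ?_⟩
  rw [h3, h1, h2]
  module

/-- With `Z = V Vᴴ`, the hypothesis equates the Gram matrices of `E V` and `F V`, so an isometry `U`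
sends `(E V)ᴴ x` to `(F V)ᴴ x`. An eigenvector `U b = l b` gives `E V b = l F V b`, and the vectors
`V b` over an orthonormal eigenbasis resolve `Z`. -/
theorem PosSemidef.exists_eq_sum_vecMulVec {ι κ : Type*} [Fintype ι] [Fintype κ]
    [DecidableEq κ] {E F : Matrix ι κ ℂ} {Z : Matrix κ κ ℂ} (hZ : Z.PosSemidef)
    (h : E * Z * Eᴴ = F * Z * Fᴴ) :
    ∃ (k : ℕ) (v : Fin k → κ → ℂ) (l : Fin k → ℂ),
      (∀ i, ‖l i‖ = 1 ∧ F *ᵥ v i = l i • (E *ᵥ v i)) ∧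
      Z = ∑ i, vecMulVec (v i) (star (v i)) := by
  obtain ⟨V, hV⟩ : ∃ V : Matrix κ κ ℂ, Z = V * Vᴴ := by
    obtain ⟨V, hV⟩ := hZ.exists_eq_conjTranspose_mul_self
    exact ⟨Vᴴ, by rw [hV, conjTranspose_conjTranspose]⟩
  obtain ⟨U, hU⟩ := exists_linearIsometry_of_mul_conjTranspose_eq (P := E * V) (Q := F * V)
    (by simpa only [hV, conjTranspose_mul, Matrix.mul_assoc] using h)
  obtain ⟨b, l, hl⟩ := U.exists_orthonormalBasis_eigenvectors
  have hl1 (i) : ‖l i‖ = 1 := by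
    have := congrArg norm (hl i)
    simpa [norm_smul] using this.symm
  have hinner (R : Matrix ι κ ℂ) (x : ι → ℂ) (y : EuclideanSpace ℂ κ) :
      inner ℂ (WithLp.toLp 2 (Rᴴ *ᵥ x)) y = star x ⬝ᵥ (R *ᵥ y.ofLp) := by
    rw [EuclideanSpace.inner_eq_star_dotProduct, dotProduct_comm, star_mulVec_dotProduct,
      conjTranspose_conjTranspose]
  refine ⟨_, fun i => V *ᵥ (b i).ofLp, fun i => (l i)⁻¹, fun i => ⟨by simp [hl1], ?_⟩, ?_⟩
  · have hl0 : l i ≠ 0 := norm_ne_zero_iff.1 (by simp [hl1])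
    rw [mulVec_mulVec, mulVec_mulVec, eq_inv_smul_iff₀ hl0]
    have key (x : ι → ℂ) : star x ⬝ᵥ (l i • (F * V) *ᵥ (b i).ofLp) =
        star x ⬝ᵥ ((E * V) *ᵥ (b i).ofLp) := by
      rw [dotProduct_smul, ← hinner, ← hinner, ← hU,
        ← U.inner_map_map (WithLp.toLp 2 ((E * V)ᴴ *ᵥ x)) (b i), hl, inner_smul_right,
        smul_eq_mul]
    refine dotProduct_eq _ _ fun x => ?_
    rw [dotProduct_comm, dotProduct_comm _ x, ← star_star x]
    exact key (star x)
  · rw [hV]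
    ext i j
    have := b.sum_inner_mul_inner (WithLp.toLp 2 fun k => star (V i k))
      (WithLp.toLp 2 fun k => star (V j k))
    simp only [EuclideanSpace.inner_eq_star_dotProduct] at this
    simp only [sum_apply, vecMulVec_apply, Pi.star_apply, mul_apply, conjTranspose_apply,
      mulVec, dotProduct, star_sum, star_mul']
    convert this.symm using 1
    · simp [dotProduct, mul_comm]
    · simp [dotProduct, mul_comm]

end Matrix

/-! ### Real functionals on matrices and the trace-one slice -/

namespace Matrix

variable {ι : Type*} [Fintype ι]

/-- Turns a separating functional into a matrix: its coefficients are read off on `single i j 1` and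
`single i j I`, and passing to the Hermitian part keeps the real quadratic form. -/
theorem exists_isHermitian_quadRe_eq [DecidableEq ι] (ψ : Matrix ι ι ℂ →ₗ[ℝ] ℝ) :
    ∃ X : Matrix ι ι ℂ, X.IsHermitian ∧ ∀ x, ψ (vecMulVec x (star x)) = X.quadRe x := by
  let X : Matrix ι ι ℂ := of fun j i =>
    (ψ (single i j 1) : ℂ) - Complex.I * ψ (single i j Complex.I)
  have hX (x : ι → ℂ) : ψ (vecMulVec x (star x)) = X.quadRe x := by
    have hs (i j : ι) (a : ℂ) : ψ (single i j a) = (X j i * a).re := by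
      have : single i j a = a.re • single i j (1 : ℂ) + a.im • single i j Complex.I := by
        ext k l
        simp only [single_apply, add_apply, smul_apply]
        split_ifs
        · simp
        · simp
      rw [this, map_add, map_smul, map_smul]
      simp [X]
      ring
    conv_lhs => rw [matrix_eq_sum_single (vecMulVec x (star x))]
    simp only [map_sum, hs, quadRe, dotProduct, mulVec, Complex.re_sum, Finset.mul_sum]
    rw [Finset.sum_comm]
    refine Finset.sum_congr rfl fun i _ => Finset.sum_congr rfl fun j _ => ?_
    rw [vecMulVec_apply]
    congr 1
    ring
  refine ⟨(2⁻¹ : ℂ) • (X + Xᴴ), ?_, fun x => ?_⟩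
  · rw [IsHermitian, conjTranspose_smul, conjTranspose_add, conjTranspose_conjTranspose, add_comm]
    simp
  · have : (Xᴴ).quadRe x = X.quadRe x := by
      rw [quadRe, star_dotProduct_comm, star_mulVec_dotProduct, conjTranspose_conjTranspose,
        Complex.star_def, Complex.conj_re, quadRe]
    have h2 := quadRe_smul_left 2⁻¹ (X + Xᴴ) x
    push_cast at h2
    rw [h2, quadRe_add_left, this, hX]
    ring

variable (ι) in
/-- Positive semidefinite matrices of trace one. -/
def densitySet : Set (Matrix ι ι ℂ) := {Z | Z.PosSemidef ∧ Z.trace = 1}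

theorem convex_densitySet : Convex ℝ (densitySet ι) := by
  rintro Z ⟨hZ, hZt⟩ Y ⟨hY, hYt⟩ a b ha hb hab
  refine ⟨(hZ.smul ha).add (hY.smul hb), ?_⟩
  rw [trace_add, trace_smul, trace_smul, hZt, hYt, ← add_smul, hab, one_smul]

theorem isCompact_densitySet [DecidableEq ι] : IsCompact (densitySet ι) := by
  refine (isCompact_setOf_norm_apply_le 1).of_isClosed_subset
    (isClosed_setOf_posSemidef.inter (isClosed_eq (by fun_prop) continuous_const)) ?_
  rintro Z ⟨hZ, hZt⟩ i j
  have hd (k : ι) : (Z k k).re ≤ 1 := by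
    have h1 : (Z k k).re ≤ ∑ l, (Z l l).re :=
      Finset.single_le_sum (f := fun l => (Z l l).re)
        (fun l _ => (Complex.nonneg_iff.1 hZ.diag_nonneg).1) (Finset.mem_univ k)
    rwa [← Complex.re_sum, show ∑ l, Z l l = 1 from hZt] at h1
  linarith [hZ.norm_apply_le i j, hd i, hd j]

end Matrix

/-! ### Frequency vectors and the strict Kalman–Yakubovich–Popov lemma -/

namespace StateSpaceModel

variable {n m : ℕ}

theorem exp_arg_mul_I {l : ℂ} (hl : ‖l‖ = 1) : Complex.exp (l.arg * Complex.I) = l := by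
  simpa [hl] using Complex.norm_mul_exp_arg_mul_I l

theorem transfer_mulVec (M : StateSpaceModel n m) {l : ℂ} (hl : l ∉ spectrum ℂ M.A)
    {x : Fin n → ℂ} {u : Fin m → ℂ} (h : M.A *ᵥ x + M.B *ᵥ u = l • x) :
    M.transfer l *ᵥ u = M.C *ᵥ x + M.D *ᵥ u := by
  have hu : IsUnit (l • (1 : Matrix (Fin n) (Fin n) ℂ) - M.A) := by
    simpa [spectrum.mem_iff, Algebra.algebraMap_eq_smul_one] using hl
  have hx : M.B *ᵥ u = (l • (1 : Matrix (Fin n) (Fin n) ℂ) - M.A) *ᵥ x := by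
    rw [sub_mulVec, smul_mulVec, one_mulVec, ← h, add_sub_cancel_left]
  rw [transfer, add_mulVec, ← mulVec_mulVec, ← mulVec_mulVec, hx, mulVec_mulVec _ _⁻¹,
    nonsing_inv_mul _ ((Matrix.isUnit_iff_isUnit_det _).1 hu), one_mulVec]

theorem exists_state (M : StateSpaceModel n m) {l : ℂ} (hl : l ∉ spectrum ℂ M.A) (u : Fin m → ℂ) :
    ∃ x, M.A *ᵥ x + M.B *ᵥ u = l • x := by
  have hu : IsUnit (l • (1 : Matrix (Fin n) (Fin n) ℂ) - M.A) := by
    simpa [spectrum.mem_iff, Algebra.algebraMap_eq_smul_one] using hl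
  refine ⟨(l • (1 : Matrix (Fin n) (Fin n) ℂ) - M.A)⁻¹ *ᵥ (M.B *ᵥ u), ?_⟩
  have h : (l • (1 : Matrix (Fin n) (Fin n) ℂ) - M.A) *ᵥ
      ((l • (1 : Matrix (Fin n) (Fin n) ℂ) - M.A)⁻¹ *ᵥ (M.B *ᵥ u)) = M.B *ᵥ u := by
    rw [mulVec_mulVec, mul_nonsing_inv _ ((Matrix.isUnit_iff_isUnit_det _).1 hu), one_mulVec]
  rw [sub_mulVec, smul_mulVec, one_mulVec, sub_eq_iff_eq_add'] at h
  exact h.symm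

theorem quadRe_Phi (M : StateSpaceModel n m) (ω : ℝ) (u : Fin m → ℂ) :
    (M.Phi ω).quadRe u =
      2 * (star u ⬝ᵥ (M.transfer (Complex.exp (ω * Complex.I)) *ᵥ u)).re := by
  rw [Phi, quadRe_add_left, two_mul]
  congr 1
  rw [quadRe, star_dotProduct_comm, star_mulVec_dotProduct, conjTranspose_conjTranspose,
    Complex.star_def, Complex.conj_re]

theorem isHermitian_Phi (M : StateSpaceModel n m) (ω : ℝ) : (M.Phi ω).IsHermitian := by
  rw [IsHermitian, Phi, conjTranspose_add, conjTranspose_conjTranspose, add_comm]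

theorem IsStrictlyPositiveReal.supply_pos {M : StateSpaceModel n m}
    (h : M.IsStrictlyPositiveReal) {l : ℂ} (hl : ‖l‖ = 1) {x : Fin n → ℂ} {u : Fin m → ℂ}
    (hxu : M.A *ᵥ x + M.B *ᵥ u = l • x) (hu : u ≠ 0) :
    0 < 2 * (star u ⬝ᵥ (M.C *ᵥ x + M.D *ᵥ u)).re := by
  obtain ⟨h1, h2⟩ := h l.arg ⟨(Complex.neg_pi_lt_arg l).le, Complex.arg_le_pi l⟩
  have := h2.quadRe_pos hu
  rw [quadRe_Phi, exp_arg_mul_I hl] at this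
  rw [exp_arg_mul_I hl] at h1
  rwa [M.transfer_mulVec h1 hxu] at this

theorem IsStrictlyPositiveReal.eq_zero {M : StateSpaceModel n m}
    (h : M.IsStrictlyPositiveReal) {l : ℂ} (hl : ‖l‖ = 1) {x : Fin n → ℂ}
    (hx : M.A *ᵥ x = l • x) : x = 0 := by
  obtain ⟨h1, -⟩ := h l.arg ⟨(Complex.neg_pi_lt_arg l).le, Complex.arg_le_pi l⟩
  rw [exp_arg_mul_I hl] at h1
  by_contra h0
  apply h1
  rw [← spectrum_toLin', ← Module.End.hasEigenvalue_iff_mem_spectrum]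
  exact Module.End.hasEigenvalue_of_hasEigenvector
    ⟨Module.End.mem_eigenspace_iff.2 (by simpa using hx), h0⟩

/-- The matrix of the quadratic form `2 Re uᴴ(C x + D u)`. -/
def supply (M : StateSpaceModel n m) : Matrix (Fin n ⊕ Fin m) (Fin n ⊕ Fin m) ℂ :=
  fromBlocks 0 M.Cᴴ M.C (M.Dᴴ + M.D)

theorem quadRe_supply (M : StateSpaceModel n m) (x : Fin n → ℂ) (u : Fin m → ℂ) :
    M.supply.quadRe (Sum.elim x u) = 2 * (star u ⬝ᵥ (M.C *ᵥ x + M.D *ᵥ u)).re := by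
  have hs : star (Sum.elim x u) = Sum.elim (star x) (star u) := by
    ext (i | i) <;> rfl
  have h3 : (star x ⬝ᵥ (M.Cᴴ *ᵥ u)).re + (star u ⬝ᵥ (M.Dᴴ *ᵥ u)).re =
      (star u ⬝ᵥ (M.C *ᵥ x + M.D *ᵥ u)).re := by
    rw [star_dotProduct_comm u (M.C *ᵥ x + M.D *ᵥ u), Complex.star_def, Complex.conj_re,
      ← Complex.add_re]
    simp only [star_add, add_dotProduct, star_mulVec_dotProduct]
  rw [two_mul]
  nth_rw 1 [← h3]
  rw [quadRe, hs, supply]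
  simp only [fromBlocks_mulVec, sumElim_dotProduct_sumElim, Sum.elim_comp_inl, Sum.elim_comp_inr,
    dotProduct_add, add_mulVec, zero_mulVec, Complex.add_re, zero_add]
  ring

/-- `Z` is a sum of `v vᴴ` with `v = (x, u)`, `A x + B u = l x`, `|l| = 1`. The supply at `v` is
positive if `u ≠ 0`; if `u = 0` then `x = 0`, as `A` has no unimodular eigenvalue. So a nonpositive
total forces every `v` to vanish. -/
theorem IsStrictlyPositiveReal.eq_zero_of_supply_nonpos {M : StateSpaceModel n m}
    (h : M.IsStrictlyPositiveReal) {Z : Matrix (Fin n ⊕ Fin m) (Fin n ⊕ Fin m) ℂ}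
    (hZ : Z.PosSemidef)
    (hEF : (fromCols 1 0 : Matrix (Fin n) (Fin n ⊕ Fin m) ℂ) * Z *
      (fromCols 1 0 : Matrix (Fin n) (Fin n ⊕ Fin m) ℂ)ᴴ =
        fromCols M.A M.B * Z * (fromCols M.A M.B)ᴴ)
    (hs : ((M.supply * Z).trace).re ≤ 0) : Z = 0 := by
  obtain ⟨k, v, l, hl, rfl⟩ := hZ.exists_eq_sum_vecMulVec hEF
  have hv (i) : 0 ≤ M.supply.quadRe (v i) ∧ (M.supply.quadRe (v i) = 0 → v i = 0) := by
    obtain ⟨hl1, hl2⟩ := hl i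
    obtain ⟨x, u, hxu⟩ : ∃ x u, v i = Sum.elim x u :=
      ⟨v i ∘ Sum.inl, v i ∘ Sum.inr, (Sum.elim_comp_inl_inr _).symm⟩
    rw [hxu] at hl2 ⊢
    simp only [fromCols_mulVec, Sum.elim_comp_inl, Sum.elim_comp_inr, one_mulVec, zero_mulVec,
      add_zero] at hl2
    rw [quadRe_supply]
    by_cases hu : u = 0
    · subst hu
      have : x = 0 := h.eq_zero hl1 (by simpa using hl2)
      subst this
      simp
    · have := h.supply_pos hl1 hl2 hu
      exact ⟨this.le, fun h0 => absurd h0 this.ne'⟩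
  have htr : ((M.supply * ∑ i, vecMulVec (v i) (star (v i))).trace).re =
      ∑ i, M.supply.quadRe (v i) := by
    simp only [Finset.mul_sum, trace_sum, Complex.re_sum, mul_vecMulVec, trace_vecMulVec, quadRe,
      dotProduct_comm]
  rw [htr] at hs
  have h0 := (Finset.sum_eq_zero_iff_of_nonneg fun i _ => (hv i).1).1
    (le_antisymm hs (Finset.sum_nonneg fun i _ => (hv i).1))
  refine Finset.sum_eq_zero fun i hi => ?_
  rw [(hv i).2 (h0 i hi), zero_vecMulVec]

/-- The strict Kalman–Yakubovich–Popov lemma, without a sign condition on `X`. -/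
theorem IsStrictlyPositiveReal.exists_isHermitian {M : StateSpaceModel n m}
    (h : M.IsStrictlyPositiveReal) (hm : 0 < m) :
    ∃ X : Matrix (Fin n) (Fin n) ℂ, X.IsHermitian ∧ ∀ x u, Sum.elim x u ≠ 0 →
      0 < X.quadRe x - X.quadRe (M.A *ᵥ x + M.B *ᵥ u) +
        2 * (star u ⬝ᵥ (M.C *ᵥ x + M.D *ᵥ u)).re := by
  let N := Fin n ⊕ Fin m
  let E : Matrix (Fin n) N ℂ := fromCols 1 0
  let F : Matrix (Fin n) N ℂ := fromCols M.A M.B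
  let g : Matrix N N ℂ →ₗ[ℝ] Matrix (Fin n) (Fin n) ℂ × ℝ :=
    { toFun Z := (E * Z * Eᴴ - F * Z * Fᴴ, ((M.supply * Z).trace).re)
      map_add' Y Z := by
        ext : 1
        · simp only [Matrix.mul_add, Matrix.add_mul, Prod.fst_add]; abel
        · simp [Matrix.mul_add]
      map_smul' r Z := by
        ext : 1
        · simp [smul_sub]
        · simp }
  have hg : Continuous g := by
    refine Continuous.prodMk ?_ ?_
    · fun_prop
    · exact Complex.continuous_re.comp (by fun_prop)
  have hlc : LocallyConvexSpace ℝ (Matrix (Fin n) (Fin n) ℂ) :=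
    inferInstanceAs (LocallyConvexSpace ℝ (Fin n → Fin n → ℂ))
  -- Disjointness is the preceding lemma. The state component of `-f` yields `X`, and the scalar
  -- component the multiplier `c` of the supply.
  obtain ⟨f, a, b, hf, hab, hfb⟩ := geometric_hahn_banach_compact_closed
    (s := g '' densitySet N) (t := {0} ×ˢ Set.Iic (0 : ℝ))
    (convex_densitySet.linear_image g) (isCompact_densitySet.image hg)
    ((convex_singleton _).prod (convex_Iic _)) (isClosed_singleton.prod isClosed_Iic) (by
      rw [Set.disjoint_left]
      rintro _ ⟨Z, ⟨hZ, hZt⟩, rfl⟩ ⟨h1, h2⟩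
      have := h.eq_zero_of_supply_nonpos hZ (sub_eq_zero.1 h1) h2
      rw [this, trace_zero] at hZt
      exact zero_ne_one hZt)
  have hb : b < 0 := by
    have := hfb 0 ⟨rfl, le_refl (0 : ℝ)⟩
    rwa [map_zero] at this
  let c : ℝ := -f (0, 1)
  let ψ : Matrix (Fin n) (Fin n) ℂ →ₗ[ℝ] ℝ := -(f.toLinearMap ∘ₗ LinearMap.inl ℝ _ ℝ)
  have hfc (H : Matrix (Fin n) (Fin n) ℂ) (r : ℝ) : ψ H + c * r = -f (H, r) := by
    have : (H, r) = (H, 0) + r • ((0, 1) : Matrix (Fin n) (Fin n) ℂ × ℝ) := by simp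
    rw [this, map_add, map_smul]
    simp [ψ, c]
    ring
  -- `f` is bounded below by `b` on a half-line going to `-∞`, which fixes the sign of `c`.
  have hc : 0 ≤ c := by
    by_contra! hc
    have h1 := hfb (0, -b / c) ⟨rfl, div_nonpos_of_nonneg_of_nonpos (by linarith) hc.le⟩
    have h2 := hfc 0 (-b / c)
    rw [map_zero, zero_add, mul_div_cancel₀ _ hc.ne] at h2
    linarith
  obtain ⟨X, hX, hψ⟩ := exists_isHermitian_quadRe_eq ψ
  have key (x : Fin n → ℂ) (u : Fin m → ℂ) (hxu : Sum.elim x u ≠ 0) :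
      0 < X.quadRe x - X.quadRe (M.A *ᵥ x + M.B *ᵥ u) +
        c * (2 * (star u ⬝ᵥ (M.C *ᵥ x + M.D *ᵥ u)).re) := by
    let v : N → ℂ := Sum.elim x u
    let r : ℝ := (star v ⬝ᵥ v).re
    have hr' : star v ⬝ᵥ v = r := (Complex.conj_eq_iff_re.1 (star_dotProduct_comm v v).symm).symm
    have hr : 0 < r := by
      have : 0 < star v ⬝ᵥ v := dotProduct_star_self_pos_iff.2 hxu
      rw [hr'] at this
      exact_mod_cast this
    have hmem : r⁻¹ • vecMulVec v (star v) ∈ densitySet N := by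
      refine ⟨(posSemidef_vecMulVec_self_star v).smul (inv_nonneg.2 hr.le), ?_⟩
      rw [trace_smul, trace_vecMulVec, dotProduct_comm, hr', ← Complex.coe_smul, smul_eq_mul,
        ← Complex.ofReal_mul, inv_mul_cancel₀ hr.ne', Complex.ofReal_one]
    have h1 := hf _ ⟨_, hmem, rfl⟩
    rw [map_smul, map_smul, smul_eq_mul] at h1
    have h2 : f (g (vecMulVec v (star v))) < 0 := by
      by_contra! h2
      have := mul_nonneg (inv_nonneg.2 hr.le) h2
      linarith
    have hR (R : Matrix (Fin n) N ℂ) :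
        R * vecMulVec v (star v) * Rᴴ = vecMulVec (R *ᵥ v) (star (R *ᵥ v)) := by
      rw [mul_vecMulVec, vecMulVec_mul, star_mulVec]
    have hE : E *ᵥ v = x := by
      change (fromCols 1 0 : Matrix (Fin n) N ℂ) *ᵥ Sum.elim x u = x
      rw [fromCols_mulVec, Sum.elim_comp_inl, Sum.elim_comp_inr, one_mulVec, zero_mulVec, add_zero]
    have hF : F *ᵥ v = M.A *ᵥ x + M.B *ᵥ u := by
      change fromCols M.A M.B *ᵥ Sum.elim x u = _
      rw [fromCols_mulVec, Sum.elim_comp_inl, Sum.elim_comp_inr]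
    have h3 : g (vecMulVec v (star v)) = (vecMulVec x (star x) -
        vecMulVec (M.A *ᵥ x + M.B *ᵥ u) (star (M.A *ᵥ x + M.B *ᵥ u)), M.supply.quadRe v) := by
      ext1
      · change E * vecMulVec v (star v) * Eᴴ - F * vecMulVec v (star v) * Fᴴ = _
        rw [hR, hR, hE, hF]
      · change ((M.supply * vecMulVec v (star v)).trace).re = _
        rw [mul_vecMulVec, trace_vecMulVec, dotProduct_comm, quadRe]
    rw [h3, quadRe_supply] at h2
    have h4 := hfc (vecMulVec x (star x) -
        vecMulVec (M.A *ᵥ x + M.B *ᵥ u) (star (M.A *ᵥ x + M.B *ᵥ u)))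
        (2 * (star u ⬝ᵥ (M.C *ᵥ x + M.D *ᵥ u)).re)
    rw [map_sub, hψ, hψ] at h4
    linarith
  -- At a steady state `A x + B u = x` with `u ≠ 0` the `X` terms cancel, so `c = 0` would give `0 <
  -- 0`.
  have hc' : 0 < c := by
    refine hc.lt_of_ne' fun h0 => ?_
    let u : Fin m → ℂ := Pi.single ⟨0, hm⟩ 1
    obtain ⟨x, hx⟩ := M.exists_state (l := 1) (by
      simpa using (h 0 ⟨by linarith [Real.pi_pos], Real.pi_pos.le⟩).1) u
    have hne : Sum.elim x u ≠ 0 := fun h => by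
      have := congrFun h (Sum.inr ⟨0, hm⟩)
      simp [u] at this
    have := key x u hne
    rw [hx, h0] at this
    simp at this
  refine ⟨((c⁻¹ : ℝ) : ℂ) • X, ?_, fun x u hxu => ?_⟩
  · rw [IsHermitian, conjTranspose_smul, hX.eq]; simp
  · have := mul_pos (inv_pos.2 hc') (key x u hxu)
    rw [quadRe_smul_left, quadRe_smul_left]
    rw [mul_add, inv_mul_cancel_left₀ hc'.ne'] at this
    linarith

end StateSpaceModel

/-! ### Perturbation of positive definite forms and Stein inequalities -/

namespace Matrix

variable {ι : Type*} [Fintype ι]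

theorem continuous_quadRe (X : Matrix ι ι ℂ) : Continuous X.quadRe := by
  unfold quadRe
  exact Complex.continuous_re.comp (by fun_prop)

theorem PosDef.exists_pos_posSemidef_sub_smul {P Q : Matrix ι ι ℂ} (hP : P.PosDef)
    (hQ : Q.IsHermitian) : ∃ ε : ℝ, 0 < ε ∧ (P - (ε : ℂ) • Q).PosSemidef := by
  have hK := isCompact_sphere (0 : ι → ℂ) 1
  obtain ⟨δ, hδ, hPδ⟩ := hK.exists_forall_le' (a := 0) P.continuous_quadRe.continuousOn
    (fun v hv => hP.quadRe_pos (ne_zero_of_mem_unit_sphere ⟨v, hv⟩))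
  obtain ⟨C, hC⟩ := hK.bddAbove_image Q.continuous_quadRe.continuousOn
  have hC' : 0 < |C| + 1 := by positivity
  -- On the unit sphere `P ≥ δ` and `Q ≤ C`; adding `1` keeps the denominator positive, and
  -- homogeneity does the rest.
  refine ⟨δ / (|C| + 1), by positivity, posSemidef_iff_quadRe.2 ⟨?_, fun v => ?_⟩⟩
  · refine hP.1.sub ?_
    rw [IsHermitian, conjTranspose_smul, hQ.eq]; simp
  · rw [quadRe_sub_left, quadRe_smul_left]
    by_cases hv : v = 0
    · simp [hv]
    have hv' : ‖v‖ ≠ 0 := norm_ne_zero_iff.2 hv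
    obtain ⟨w, hw, hvw⟩ : ∃ w ∈ Metric.sphere (0 : ι → ℂ) 1, v = (‖v‖ : ℂ) • w := by
      refine ⟨(‖v‖ : ℂ)⁻¹ • v, by simp [norm_smul, hv'], ?_⟩
      rw [smul_inv_smul₀ (by simpa using hv)]
    rw [hvw, quadRe_smul, quadRe_smul]
    have h1 := hPδ w hw
    have h2 : Q.quadRe w ≤ |C| + 1 :=
      (hC ⟨w, hw, rfl⟩).trans ((le_abs_self C).trans (by linarith))
    have h3 : δ / (|C| + 1) * Q.quadRe w ≤ δ := by
      calc _ ≤ δ / (|C| + 1) * (|C| + 1) := by gcongr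
        _ = δ := div_mul_cancel₀ _ hC'.ne'
    have := mul_nonneg (sq_nonneg ‖(‖v‖ : ℂ)‖) (sub_nonneg.2 (h3.trans h1))
    linarith

section Stein

variable [DecidableEq ι]

attribute [local instance] Matrix.linftyOpNormedRing Matrix.linftyOpNormedAlgebra in
theorem tendsto_pow_zero_of_spectrum_subset_ball {A : Matrix ι ι ℂ}
    (hA : ∀ μ ∈ spectrum ℂ A, ‖μ‖ < 1) : Filter.Tendsto (fun k => A ^ k) Filter.atTop (nhds 0) := by
  have hcomp : CompleteSpace (Matrix ι ι ℂ) := FiniteDimensional.complete ℂ _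
  have hρ : spectralRadius ℂ A < 1 := by
    cases subsingleton_or_nontrivial (Matrix ι ι ℂ)
    · simp
    obtain ⟨μ, hμ, h⟩ := spectrum.exists_nnnorm_eq_spectralRadius A
    rw [← h]
    exact_mod_cast hA μ hμ
  obtain ⟨r, hr, hr1⟩ := exists_between hρ
  lift r to NNReal using hr1.ne_top
  have hr1' : (r : ℝ) < 1 := by exact_mod_cast hr1
  -- Gelfand's formula: eventually `‖A ^ k‖ < r ^ k` with `r < 1`.
  have hev := (spectrum.pow_nnnorm_pow_one_div_tendsto_nhds_spectralRadius A).eventually_lt_const hr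
  refine squeeze_zero_norm' ?_ (tendsto_pow_atTop_nhds_zero_of_lt_one r.2 hr1')
  filter_upwards [hev, Filter.eventually_gt_atTop 0] with k hk hk0
  rw [one_div, ENNReal.rpow_inv_lt_iff (by positivity), ENNReal.rpow_natCast] at hk
  exact_mod_cast hk.le

/-- Along the orbit `A ^ k x` the form decreases to `0`, so it is nonnegative at `A x` and strictly
larger at `x`. -/
theorem IsHermitian.posDef_of_quadRe_mulVec_lt {A X : Matrix ι ι ℂ} (hX : X.IsHermitian)
    (hA : ∀ μ ∈ spectrum ℂ A, ‖μ‖ < 1) (h : ∀ x, x ≠ 0 → X.quadRe (A *ᵥ x) < X.quadRe x) :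
    X.PosDef := by
  refine posDef_iff_quadRe.2 ⟨hX, fun x hx => lt_of_le_of_lt ?_ (h x hx)⟩
  have hanti : Antitone fun k => X.quadRe ((A ^ k) *ᵥ x) := by
    refine antitone_nat_of_succ_le fun k => ?_
    rw [pow_succ', ← mulVec_mulVec]
    by_cases hk : (A ^ k) *ᵥ x = 0
    · simp [hk]
    · exact (h _ hk).le
  have hlim : Filter.Tendsto (fun k => X.quadRe ((A ^ k) *ᵥ x)) Filter.atTop (nhds 0) := by
    have hc : Continuous fun B : Matrix ι ι ℂ => X.quadRe (B *ᵥ x) :=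
      X.continuous_quadRe.comp (by fun_prop)
    have := (hc.tendsto 0).comp (tendsto_pow_zero_of_spectrum_subset_ball hA)
    rwa [zero_mulVec, quadRe_zero_right] at this
  simpa using hanti.le_of_tendsto hlim 1

theorem exists_mulVec_eq_smul_of_mem_spectrum {A : Matrix ι ι ℂ} {μ : ℂ} (h : μ ∈ spectrum ℂ A) :
    ∃ x, x ≠ 0 ∧ A *ᵥ x = μ • x := by
  rw [← spectrum_toLin', ← Module.End.hasEigenvalue_iff_mem_spectrum] at h
  obtain ⟨x, hx⟩ := h.exists_hasEigenvector
  exact ⟨x, hx.2, by simpa using hx.apply_eq_smul⟩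

omit [DecidableEq ι] in
-- A contraction has no Jordan chain on the unit circle: at `x + s μ̄ y` the energy gained under `A`
-- is affine in `s` with slope `2 yᴴ X y`, yet never positive.
theorem PosDef.eq_zero_of_mulVec_eq_smul_add {A X : Matrix ι ι ℂ} (hX : X.PosDef)
    (hA : ∀ x, X.quadRe (A *ᵥ x) ≤ X.quadRe x) {μ : ℂ} (hμ : ‖μ‖ = 1) {x y : ι → ℂ}
    (hy : A *ᵥ y = μ • y) (hx : A *ᵥ x = μ • x + y) : y = 0 := by
  refine hX.eq_zero_of_quadRe_nonpos ?_
  by_contra! hpos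
  have hμ' : (starRingEnd ℂ) μ * μ = 1 := by
    rw [Complex.conj_mul', hμ]; simp
  have key (s : ℝ) : 2 * (star (μ • x) ⬝ᵥ (X *ᵥ y)).re + 2 * s * X.quadRe y + X.quadRe y ≤ 0 := by
    have h1 := hA (x + ((s : ℂ) * (starRingEnd ℂ) μ) • y)
    have h2 : A *ᵥ (x + ((s : ℂ) * (starRingEnd ℂ) μ) • y) =
        μ • (x + ((s : ℂ) * (starRingEnd ℂ) μ) • y) + y := by
      rw [mulVec_add, mulVec_smul, hx, hy]
      module
    rw [h2, hX.1.quadRe_add, quadRe_smul, hμ] at h1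
    have h3 : μ • (x + ((s : ℂ) * (starRingEnd ℂ) μ) • y) = μ • x + (s : ℂ) • y := by
      rw [smul_add, smul_smul, mul_left_comm, mul_comm μ, hμ', mul_one]
    have h4 : (star (μ • (x + ((s : ℂ) * (starRingEnd ℂ) μ) • y)) ⬝ᵥ (X *ᵥ y)).re =
        (star (μ • x) ⬝ᵥ (X *ᵥ y)).re + s * X.quadRe y := by
      rw [h3, star_add, add_dotProduct, Complex.add_re, star_smul (s : ℂ), smul_dotProduct, quadRe]
      simp
    rw [h4] at h1
    linarith
  have := key (|(star (μ • x) ⬝ᵥ (X *ᵥ y)).re| / X.quadRe y)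
  have h5 : 2 * (|(star (μ • x) ⬝ᵥ (X *ᵥ y)).re| / X.quadRe y) * X.quadRe y =
      2 * |(star (μ • x) ⬝ᵥ (X *ᵥ y)).re| := by
    field_simp
  rw [h5] at this
  linarith [neg_abs_le (star (μ • x) ⬝ᵥ (X *ᵥ y)).re]

end Stein

end Matrix

/-! ### Certificates versus passivity -/

namespace StateSpaceModel

variable {n m : ℕ}

theorem IsStrictlyPassive.wtildeSet_nonempty {M : StateSpaceModel n m} (h : M.IsStrictlyPassive)
    (hm : 0 < m) : M.wtildeSet.Nonempty := by
  obtain ⟨X, hX, hpos⟩ := h.1.exists_isHermitian hm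
  -- The case `u = 0` is a strict Stein inequality; stability then supplies the sign of `X`.
  have hXpos : X.PosDef := hX.posDef_of_quadRe_mulVec_lt h.2 fun x hx => by
    have := hpos x 0 (fun h0 => hx (by simpa using congrArg (· ∘ Sum.inl) h0))
    simp at this
    exact this
  refine ⟨X, hXpos, posSemidef_iff_quadRe.2 ⟨M.isHermitian_Wtilde hX, fun v => ?_⟩⟩
  obtain ⟨w, x, u, rfl⟩ : ∃ w x u, v = Sum.elim (Sum.elim w x) u :=
    ⟨_, _, _, by rw [← Sum.elim_comp_inl_inr v, ← Sum.elim_comp_inl_inr (v ∘ Sum.inl)]⟩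
  rw [quadRe_Wtilde _ hX]
  have h1 := hX.quadRe_add w (M.A *ᵥ x + M.B *ᵥ u)
  have h2 := hXpos.posSemidef.quadRe_nonneg (w + (M.A *ᵥ x + M.B *ᵥ u))
  by_cases h0 : Sum.elim x u = 0
  · have hx : x = 0 := by simpa using congrArg (· ∘ Sum.inl) h0
    have hu : u = 0 := by simpa using congrArg (· ∘ Sum.inr) h0
    subst hx hu
    simpa using hXpos.posSemidef.quadRe_nonneg w
  · linarith [hpos x u h0]

/-- With `w = -l x` and `|l| = 1` all `X` terms cancel, so `Φ` is a restriction of the form of `W̃`.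
-/
theorem quadRe_Wtilde_of_state (M : StateSpaceModel n m) {X : Matrix (Fin n) (Fin n) ℂ}
    (hX : X.IsHermitian) {l : ℂ} (hl : ‖l‖ = 1) {x : Fin n → ℂ} {u : Fin m → ℂ}
    (h : M.A *ᵥ x + M.B *ᵥ u = l • x) :
    (M.Wtilde X).quadRe (Sum.elim (Sum.elim (-(l • x)) x) u) =
      2 * (star u ⬝ᵥ (M.C *ᵥ x + M.D *ᵥ u)).re := by
  have h1 : (star (-(l • x)) ⬝ᵥ (X *ᵥ (l • x))).re = -X.quadRe (l • x) := by
    simp only [quadRe, star_neg, neg_dotProduct, Complex.neg_re]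
  rw [quadRe_Wtilde _ hX, h, h1, ← neg_one_smul ℂ (l • x), quadRe_smul, quadRe_smul, hl]
  simp
  ring

theorem quadRe_Phi_eq (M : StateSpaceModel n m) {X : Matrix (Fin n) (Fin n) ℂ}
    (hX : X.IsHermitian) {ω : ℝ} (hω : Complex.exp (ω * Complex.I) ∉ spectrum ℂ M.A)
    (u : Fin m → ℂ) : ∃ w, (M.Phi ω).quadRe u = (M.Wtilde X).quadRe (Sum.elim w u) := by
  obtain ⟨x, hx⟩ := M.exists_state hω u
  refine ⟨Sum.elim (-(Complex.exp (ω * Complex.I) • x)) x, ?_⟩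
  rw [M.quadRe_Wtilde_of_state hX (Complex.norm_exp_ofReal_mul_I ω) hx, quadRe_Phi,
    M.transfer_mulVec hω hx]

theorem isPassive_of_mem_wtildeSet {M : StateSpaceModel n m} {X : Matrix (Fin n) (Fin n) ℂ}
    (h : X ∈ M.wtildeSet) : M.IsPassive := by
  obtain ⟨hX, hW⟩ := h
  have hA := quadRe_A_mulVec_le hX.1 hW
  refine ⟨fun ω _ hω => posSemidef_iff_quadRe.2 ⟨M.isHermitian_Phi ω, fun u => ?_⟩,
    fun μ hμ => ⟨?_, fun hμ1 => ?_⟩⟩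
  · obtain ⟨w, hw⟩ := M.quadRe_Phi_eq hX.1 hω u
    exact hw ▸ hW.quadRe_nonneg _
  · obtain ⟨x, hx, hAx⟩ := exists_mulVec_eq_smul_of_mem_spectrum hμ
    have := hA x
    rw [hAx, quadRe_smul] at this
    have h1 := le_of_mul_le_mul_right (this.trans_eq (one_mul _).symm) (hX.quadRe_pos hx)
    exact (sq_le_one_iff₀ (norm_nonneg _)).1 h1
  · refine le_antisymm ?_ Module.End.eigenspace_le_maxGenEigenspace
    · intro x hx
      obtain ⟨k, hk⟩ := Module.End.mem_maxGenEigenspace _ _ _ |>.1 hx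
      rw [Module.End.mem_eigenspace_iff, ← sub_eq_zero]
      clear hx
      induction k generalizing x with
      | zero =>
        have : x = 0 := by simpa using hk
        simp [this]
      | succ k ih =>
        -- Induction makes `(A - μ) x` an eigenvector, leaving only a chain of length two to
        -- exclude.
        have h1 := ih (x := (toLin' M.A - μ • 1) x)
          (by rwa [pow_succ, Module.End.mul_apply] at hk)
        refine hX.eq_zero_of_mulVec_eq_smul_add hA hμ1 (x := x) (sub_eq_zero.1 ?_) ?_
        · simpa using h1
        · simp

theorem isStrictlyPassive_of_mem_wtildeStrictSet {M : StateSpaceModel n m}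
    {X : Matrix (Fin n) (Fin n) ℂ} (h : X ∈ M.wtildeStrictSet) : M.IsStrictlyPassive := by
  obtain ⟨hX, hW⟩ := h
  have hstab : M.IsAsymptoticallyStable := by
    intro μ hμ
    obtain ⟨x, hx, hAx⟩ := exists_mulVec_eq_smul_of_mem_spectrum hμ
    have h1 : (Sum.elim (Sum.elim (-(M.A *ᵥ x)) x) (0 : Fin m → ℂ)) ≠ 0 := fun h0 => hx <| by
      ext i; exact congrFun h0 (Sum.inl (Sum.inr i))
    have h2 := hW.quadRe_pos h1
    rw [quadRe_Wtilde _ hX.1, hAx] at h2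
    have h3 : (star (-(μ • x)) ⬝ᵥ (X *ᵥ (μ • x))).re = -X.quadRe (μ • x) := by
      simp only [quadRe, star_neg, neg_dotProduct, Complex.neg_re]
    rw [mulVec_zero, add_zero, h3, ← neg_one_smul ℂ (μ • x), quadRe_smul, quadRe_smul] at h2
    simp at h2
    refine (sq_lt_one_iff₀ (norm_nonneg _)).1 (lt_of_mul_lt_mul_right ?_ (hX.quadRe_pos hx).le)
    linarith
  refine ⟨fun ω _ => ?_, hstab⟩
  have hω : Complex.exp (ω * Complex.I) ∉ spectrum ℂ M.A := fun hω => by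
    have := hstab _ hω
    rw [Complex.norm_exp_ofReal_mul_I] at this
    exact lt_irrefl _ this
  refine ⟨hω, posDef_iff_quadRe.2 ⟨M.isHermitian_Phi ω, fun u hu => ?_⟩⟩
  obtain ⟨w, hw⟩ := M.quadRe_Phi_eq hX.1 hω u
  refine hw ▸ hW.quadRe_pos fun h0 => hu ?_
  ext i; exact congrFun h0 (Sum.inr i)

theorem W_eq (M : StateSpaceModel n m) (X : Matrix (Fin n) (Fin n) ℂ) :
    M.W X = M.supply + fromBlocks X 0 0 0 -
      (fromCols M.A M.B)ᴴ * X * fromCols M.A M.B := by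
  rw [conjTranspose_fromCols_eq_fromRows_conjTranspose, fromRows_mul, fromRows_mul_fromCols,
    supply, fromBlocks_add, sub_eq_add_neg, fromBlocks_neg, fromBlocks_add, W]
  simp [sub_eq_add_neg]

theorem quadRe_W (M : StateSpaceModel n m) (X : Matrix (Fin n) (Fin n) ℂ)
    (x : Fin n → ℂ) (u : Fin m → ℂ) :
    (M.W X).quadRe (Sum.elim x u) = X.quadRe x - X.quadRe (M.A *ᵥ x + M.B *ᵥ u) +
      2 * (star u ⬝ᵥ (M.C *ᵥ x + M.D *ᵥ u)).re := by
  have h1 : (fromBlocks X 0 0 (0 : Matrix (Fin m) (Fin m) ℂ)).quadRe (Sum.elim x u) =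
      X.quadRe x := by
    simp [quadRe, dotProduct, mulVec]
  rw [W_eq, quadRe_sub_left, quadRe_add_left, quadRe_conjTranspose_mul_mul, quadRe_supply, h1,
    fromCols_mulVec, Sum.elim_comp_inl, Sum.elim_comp_inr]
  ring

theorem isHermitian_W (M : StateSpaceModel n m) {X : Matrix (Fin n) (Fin n) ℂ}
    (hX : X.IsHermitian) : (M.W X).IsHermitian := by
  rw [W_eq]
  refine IsHermitian.sub (IsHermitian.add ?_ ?_) (isHermitian_conjTranspose_mul_mul _ hX)
  · refine IsHermitian.fromBlocks isHermitian_zero (conjTranspose_conjTranspose _) ?_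
    rw [IsHermitian, conjTranspose_add, conjTranspose_conjTranspose, add_comm]
  · exact IsHermitian.fromBlocks hX (conjTranspose_zero) isHermitian_zero

/-- Schur complement: the form of `W̃` at `(w, x, u)` is that of `W` at `(x, u)` plus the `X`-energy
of `w + A x + B u`. -/
theorem solutionSet_eq_wtildeSet (M : StateSpaceModel n m) : M.solutionSet = M.wtildeSet := by
  ext X
  refine and_comm.trans (and_congr_right fun hX => ?_)
  rw [posSemidef_iff_quadRe, posSemidef_iff_quadRe]
  refine and_congr ⟨fun _ => M.isHermitian_Wtilde hX.1, fun _ => M.isHermitian_W hX.1⟩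
    ⟨fun h v => ?_, fun h v => ?_⟩
  · obtain ⟨w, x, u, rfl⟩ : ∃ w x u, v = Sum.elim (Sum.elim w x) u :=
      ⟨_, _, _, by rw [← Sum.elim_comp_inl_inr v, ← Sum.elim_comp_inl_inr (v ∘ Sum.inl)]⟩
    have h1 := hX.1.quadRe_add w (M.A *ᵥ x + M.B *ᵥ u)
    have h2 := hX.posSemidef.quadRe_nonneg (w + (M.A *ᵥ x + M.B *ᵥ u))
    have h3 := h (Sum.elim x u)
    rw [quadRe_W] at h3
    rw [quadRe_Wtilde _ hX.1]
    linarith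
  · obtain ⟨x, u, rfl⟩ : ∃ x u, v = Sum.elim x u := ⟨_, _, (Sum.elim_comp_inl_inr v).symm⟩
    have h1 := h (Sum.elim (Sum.elim (-(M.A *ᵥ x + M.B *ᵥ u)) x) u)
    rw [quadRe_Wtilde _ hX.1, ← neg_one_smul ℂ (M.A *ᵥ x + M.B *ᵥ u), quadRe_smul] at h1
    have h3 : (star ((-1 : ℂ) • (M.A *ᵥ x + M.B *ᵥ u)) ⬝ᵥ (X *ᵥ (M.A *ᵥ x + M.B *ᵥ u))).re =
        -X.quadRe (M.A *ᵥ x + M.B *ᵥ u) := by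
      rw [neg_one_smul]
      simp only [quadRe, star_neg, neg_dotProduct, Complex.neg_re]
    rw [h3] at h1
    rw [quadRe_W]
    rw [norm_neg, norm_one] at h1
    linarith

theorem Wtilde_sub_smul_weight (M : StateSpaceModel n m) {ξ : ℝ} (hξ : ξ < 1)
    (X : Matrix (Fin n) (Fin n) ℂ) :
    M.Wtilde X - (ξ : ℂ) • weight m X = ((1 - ξ : ℝ) : ℂ) • (M.shift ξ).Wtilde X := by
  have hcs (c : ℂ) {k l₁ l₂ : ℕ} (P : Matrix (Fin k) (Fin l₁) ℂ) (Q : Matrix (Fin k) (Fin l₂) ℂ) :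
      c • fromCols P Q = fromCols (c • P) (c • Q) := by
    ext i (j | j) <;> rfl
  have hrs (c : ℂ) {k l₁ l₂ : ℕ} (P : Matrix (Fin l₁) (Fin k) ℂ) (Q : Matrix (Fin l₂) (Fin k) ℂ) :
      c • fromRows P Q = fromRows (c • P) (c • Q) := by
    ext (i | i) j <;> rfl
  obtain ⟨c, hc, hc0⟩ : ∃ c : ℝ, 1 - ξ = c ∧ (c : ℂ) ≠ 0 :=
    ⟨_, rfl, by exact_mod_cast (sub_pos.2 hξ).ne'⟩
  have hs : star ((c : ℂ)⁻¹) = (c : ℂ)⁻¹ := by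
    rw [star_inv₀, Complex.star_def, Complex.conj_ofReal]
  have hX : X + -((ξ : ℂ) • X) = (c : ℂ) • X := by
    rw [← hc]; push_cast; module
  simp only [Wtilde, weight, shift, hc]
  simp only [fromBlocks_smul, sub_eq_add_neg, fromBlocks_neg, fromBlocks_add,
    hcs, hrs, conjTranspose_smul, hs, Matrix.smul_mul, Matrix.mul_smul, smul_inv_smul₀ hc0,
    smul_zero, neg_zero, add_zero, hX]
  congr 1
  rw [smul_add, smul_inv_smul₀ hc0, smul_inv_smul₀ hc0, conjTranspose_add, conjTranspose_neg,
    conjTranspose_smul, conjTranspose_one, Complex.star_def, Complex.conj_ofReal]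
  module

end StateSpaceModel

/-! ### Feasible levels `ξ` and their maximum -/

namespace StateSpaceModel

variable {n m : ℕ}

theorem isHermitian_weight {X : Matrix (Fin n) (Fin n) ℂ} (hX : X.IsHermitian) :
    (weight m X).IsHermitian := by
  refine IsHermitian.fromBlocks (IsHermitian.fromBlocks hX (conjTranspose_zero) hX)
    (conjTranspose_zero) ?_
  rw [IsHermitian, conjTranspose_smul, conjTranspose_one]
  simp

theorem quadRe_weight (X : Matrix (Fin n) (Fin n) ℂ) (w x : Fin n → ℂ) (u : Fin m → ℂ) :
    (weight m X).quadRe (Sum.elim (Sum.elim w x) u) =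
      X.quadRe w + X.quadRe x + 2 * (star u ⬝ᵥ u).re := by
  simp [weight, quadRe, dotProduct, mulVec, Finset.mul_sum, one_apply]
  exact Finset.sum_congr rfl fun i _ => by ring

theorem posDef_weight {X : Matrix (Fin n) (Fin n) ℂ} (hX : X.PosDef) : (weight m X).PosDef := by
  refine posDef_iff_quadRe.2 ⟨isHermitian_weight hX.1, fun v hv => ?_⟩
  obtain ⟨w, x, u, rfl⟩ : ∃ w x u, v = Sum.elim (Sum.elim w x) u :=
    ⟨_, _, _, by rw [← Sum.elim_comp_inl_inr v, ← Sum.elim_comp_inl_inr (v ∘ Sum.inl)]⟩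
  rw [quadRe_weight]
  have h1 := hX.posSemidef.quadRe_nonneg w
  have h2 := hX.posSemidef.quadRe_nonneg x
  have h3 : 0 ≤ (star u ⬝ᵥ u).re := (Complex.nonneg_iff.1 (dotProduct_star_self_nonneg u)).1
  by_contra! h
  have hw : w = 0 := hX.eq_zero_of_quadRe_nonpos (by linarith)
  have hx : x = 0 := hX.eq_zero_of_quadRe_nonpos (by linarith)
  have hu : u = 0 := by
    by_contra hu
    have := (Complex.pos_iff.1 (dotProduct_star_self_pos_iff.2 hu)).1
    linarith
  subst hw hx hu
  exact hv (by ext ((i | i) | i) <;> rfl)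

theorem continuous_weight : Continuous (weight (n := n) m) :=
  (continuous_id.matrix_fromBlocks continuous_const continuous_const continuous_id).matrix_fromBlocks
    continuous_const continuous_const continuous_const

theorem isClosed_feasible (M : StateSpaceModel n m) :
    IsClosed {p : ℝ × Matrix (Fin n) (Fin n) ℂ |
      (M.Wtilde p.2 - (p.1 : ℂ) • weight m p.2).PosSemidef} := by
  refine isClosed_setOf_posSemidef.preimage ?_
  exact (M.continuous_Wtilde.comp continuous_snd).sub
    ((Complex.continuous_ofReal.comp continuous_fst).smul (continuous_weight.comp continuous_snd))

theorem quadRe_Wtilde_sub_nonneg {M : StateSpaceModel n m} {X : Matrix (Fin n) (Fin n) ℂ} {ξ : ℝ}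
    (hX : X.IsHermitian) (h : ξ ∈ M.xiFeasible X) (w x : Fin n → ℂ) (u : Fin m → ℂ) :
    0 ≤ (1 - ξ) * X.quadRe w + 2 * (star w ⬝ᵥ (X *ᵥ (M.A *ᵥ x + M.B *ᵥ u))).re +
      (1 - ξ) * X.quadRe x + 2 * (star u ⬝ᵥ (M.C *ᵥ x + M.D *ᵥ u)).re -
      ξ * (2 * (star u ⬝ᵥ u).re) := by
  have := PosSemidef.quadRe_nonneg h (Sum.elim (Sum.elim w x) u)
  rw [quadRe_sub_left, quadRe_smul_left, quadRe_Wtilde _ hX, quadRe_weight] at this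
  linarith

theorem le_one_of_mem_xiFeasible {M : StateSpaceModel n m} {X : Matrix (Fin n) (Fin n) ℂ} {ξ : ℝ}
    (hn : 0 < n) (hX : X.PosDef) (h : ξ ∈ M.xiFeasible X) : ξ ≤ 1 := by
  have hw : (Pi.single ⟨0, hn⟩ 1 : Fin n → ℂ) ≠ 0 := by simp
  have h1 := quadRe_Wtilde_sub_nonneg hX.1 h (Pi.single ⟨0, hn⟩ 1) 0 0
  have h2 := hX.quadRe_pos hw
  simp at h1
  by_contra! h3
  nlinarith

theorem IsMinimal.ne_zero {M : StateSpaceModel n m} (hM : M.IsMinimal) (hn : 0 < n)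
    (h : ∀ u, M.B *ᵥ u = 0) : ∃ x, M.A *ᵥ x ≠ 0 := by
  by_contra! hA
  have := hM.1.submodule_eq_top ⊥ (fun x _ => hA x) h
  have : (Pi.single ⟨0, hn⟩ 1 : Fin n → ℂ) ∈ (⊥ : Submodule ℂ (Fin n → ℂ)) :=
    this ▸ Submodule.mem_top
  simp at this

theorem IsMinimal.pos {M : StateSpaceModel n m} (hM : M.IsMinimal) (hn : 0 < n) : 0 < m := by
  by_contra! hm
  obtain rfl : m = 0 := by omega
  have hB (u : Fin 0 → ℂ) : M.B *ᵥ u = 0 := by simp [Subsingleton.elim u 0]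
  have := hM.1.submodule_eq_top ⊥ (fun x hx => by simp [(Submodule.mem_bot ℂ).1 hx]) hB
  have : (Pi.single ⟨0, hn⟩ 1 : Fin n → ℂ) ∈ (⊥ : Submodule ℂ (Fin n → ℂ)) :=
    this ▸ Submodule.mem_top
  simp at this

/-- At `ξ = 1` the term quadratic in `w` disappears, so the linear one must vanish too. This forces
`A x + B u = 0` for all `x, u`, against controllability. -/
theorem IsMinimal.one_notMem_xiFeasible {M : StateSpaceModel n m} (hM : M.IsMinimal) (hn : 0 < n)
    {X : Matrix (Fin n) (Fin n) ℂ} (hX : X.PosDef) : 1 ∉ M.xiFeasible X := by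
  intro h
  have key (x u) : M.A *ᵥ x + M.B *ᵥ u = 0 := by
    refine hX.eq_zero_of_quadRe_nonpos ?_
    by_contra! hpos
    let y := M.A *ᵥ x + M.B *ᵥ u
    let r := (star u ⬝ᵥ (M.C *ᵥ x + M.D *ᵥ u)).re - (star u ⬝ᵥ u).re
    have h1 (s : ℝ) : s * X.quadRe y ≤ r := by
      have h2 := quadRe_Wtilde_sub_nonneg hX.1 h (-((s : ℂ) • y)) x u
      have h3 : (star (-((s : ℂ) • y)) ⬝ᵥ (X *ᵥ y)).re = -(s * X.quadRe y) := by
        rw [star_neg, neg_dotProduct, star_smul, smul_dotProduct, quadRe]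
        simp
      simp only [sub_self, zero_mul, zero_add, add_zero] at h2
      rw [h3] at h2
      simp only [r]
      linarith
    have := h1 ((|r| + 1) / X.quadRe y)
    rw [div_mul_cancel₀ _ hpos.ne'] at this
    linarith [le_abs_self r]
  obtain ⟨x, hx⟩ := hM.ne_zero hn (fun u => by simpa using key 0 u)
  exact hx (by simpa using key x 0)

theorem mem_xiFeasible_iff {M : StateSpaceModel n m} {X : Matrix (Fin n) (Fin n) ℂ} {ξ : ℝ}
    (hξ : ξ < 1) : ξ ∈ M.xiFeasible X ↔ ((M.shift ξ).Wtilde X).PosSemidef := by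
  have hc : (0 : ℝ) < 1 - ξ := sub_pos.2 hξ
  have hc' : ((1 - ξ : ℝ) : ℂ) ≠ 0 := by exact_mod_cast hc.ne'
  rw [xiFeasible, Set.mem_ofPred_eq, Wtilde_sub_smul_weight M hξ]
  refine ⟨fun h => ?_, fun h => h.smul (by exact_mod_cast hc.le)⟩
  have := h.smul (a := ((((1 - ξ)⁻¹ : ℝ)) : ℂ)) (by exact_mod_cast (inv_pos.2 hc).le)
  rwa [Complex.ofReal_inv, inv_smul_smul₀ hc'] at this

theorem posDef_shift_Wtilde_iff {M : StateSpaceModel n m} {X : Matrix (Fin n) (Fin n) ℂ} {ξ : ℝ}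
    (hξ : ξ < 1) : ((M.shift ξ).Wtilde X).PosDef ↔
      (M.Wtilde X - (ξ : ℂ) • weight m X).PosDef := by
  have hc : (0 : ℝ) < 1 - ξ := sub_pos.2 hξ
  have hc' : ((1 - ξ : ℝ) : ℂ) ≠ 0 := by exact_mod_cast hc.ne'
  rw [Wtilde_sub_smul_weight M hξ]
  refine ⟨fun h => h.smul (by exact_mod_cast hc), fun h => ?_⟩
  have := h.smul (a := ((((1 - ξ)⁻¹ : ℝ)) : ℂ)) (by exact_mod_cast inv_pos.2 hc)
  rwa [Complex.ofReal_inv, inv_smul_smul₀ hc'] at this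

theorem posDef_sub_smul_weight_of_lt {M : StateSpaceModel n m} {X : Matrix (Fin n) (Fin n) ℂ}
    {ξ η : ℝ} (hX : X.PosDef) (h : ξ ∈ M.xiFeasible X) (hη : η < ξ) :
    (M.Wtilde X - (η : ℂ) • weight m X).PosDef := by
  have h1 : M.Wtilde X - (η : ℂ) • weight m X =
      (M.Wtilde X - (ξ : ℂ) • weight m X) + ((ξ - η : ℝ) : ℂ) • weight m X := by
    push_cast; module
  rw [h1]
  exact PosDef.posSemidef_add h ((posDef_weight hX).smul (by exact_mod_cast sub_pos.2 hη))

theorem mem_xiFeasible_of_le {M : StateSpaceModel n m} {X : Matrix (Fin n) (Fin n) ℂ}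
    {ξ η : ℝ} (hX : X.PosDef) (h : ξ ∈ M.xiFeasible X) (hη : η ≤ ξ) : η ∈ M.xiFeasible X := by
  rcases hη.eq_or_lt with rfl | hη
  · exact h
  · exact (posDef_sub_smul_weight_of_lt hX h hη).posSemidef

theorem zero_mem_xiFeasible_iff {M : StateSpaceModel n m} {X : Matrix (Fin n) (Fin n) ℂ} :
    0 ∈ M.xiFeasible X ↔ (M.Wtilde X).PosSemidef := by
  simp [xiFeasible]

theorem isGreatest_xiStar {M : StateSpaceModel n m} (hn : 0 < n) {X : Matrix (Fin n) (Fin n) ℂ}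
    (h : X ∈ M.wtildeSet) : IsGreatest (M.xiFeasible X) (M.xiStar X) := by
  have hclosed : IsClosed (M.xiFeasible X) :=
    M.isClosed_feasible.preimage (Continuous.prodMk_left X)
  have hbdd : BddAbove (M.xiFeasible X) := ⟨1, fun ξ hξ => le_one_of_mem_xiFeasible hn h.1 hξ⟩
  exact ⟨hclosed.csSup_mem ⟨0, zero_mem_xiFeasible_iff.2 h.2⟩ hbdd, fun ξ hξ => le_csSup hbdd hξ⟩

/-- The largest `ξ` that is feasible for some certificate of passivity. -/
theorem IsMinimal.exists_maximal_feasible {M : StateSpaceModel n m} (hM : M.IsMinimal) (hn : 0 < n)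
    (hne : M.wtildeSet.Nonempty) :
    ∃ Ξ : ℝ, 0 ≤ Ξ ∧ Ξ < 1 ∧ (∃ X ∈ M.wtildeSet, Ξ ∈ M.xiFeasible X) ∧
      ∀ X : Matrix (Fin n) (Fin n) ℂ, X.PosDef → ∀ ξ ∈ M.xiFeasible X, ξ ≤ Ξ := by
  have hK : IsCompact ((Set.Icc (0 : ℝ) 1 ×ˢ M.wtildeSet) ∩
      {p | (M.Wtilde p.2 - (p.1 : ℂ) • weight m p.2).PosSemidef}) :=
    (isCompact_Icc.prod (isCompact_wtildeSet hM)).inter_right M.isClosed_feasible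
  obtain ⟨X₀, hX₀⟩ := hne
  obtain ⟨⟨Ξ, X⟩, ⟨⟨hΞ, hX⟩, hf⟩, hmax⟩ := hK.exists_isMaxOn
    ⟨(0, X₀), ⟨⟨by simp, hX₀⟩, zero_mem_xiFeasible_iff.2 hX₀.2⟩⟩ continuous_fst.continuousOn
  refine ⟨Ξ, hΞ.1, hΞ.2.lt_of_ne ?_, ⟨X, hX, hf⟩, fun Y hY ξ hξ => ?_⟩
  · rintro rfl
    exact hM.one_notMem_xiFeasible hn hX.1 hf
  -- A larger `ξ` for `Y` would be nonnegative, so level `0` is feasible as well: `Y` certifies `M`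
  -- itself and `(ξ, Y)` lies in the compact set.
  · by_contra! hlt
    have h0 : 0 ≤ ξ := hΞ.1.trans hlt.le
    exact hlt.not_ge <| hmax (show (ξ, Y) ∈ _ from
      ⟨⟨⟨h0, le_one_of_mem_xiFeasible hn hY hξ⟩, hY,
        zero_mem_xiFeasible_iff.1 (mem_xiFeasible_of_le hY hξ h0)⟩, hξ⟩)

end StateSpaceModel

end

/-! ### The main theorem -/

open StateSpaceModel in
theorem mainTheorem2 {n m : ℕ} (hn : 0 < n) (M : StateSpaceModel n m)
    (hmin : M.IsMinimal) (hpass : M.IsStrictlyPassive) :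
    ∃ Ξ : ℝ,
      IsLUB {ξ : ℝ | ξ < 1 ∧ (M.shift ξ).IsStrictlyPassive} Ξ ∧
      Ξ < 1 ∧
      (M.shift Ξ).IsPassive ∧
      (M.shift Ξ).wtildeSet.Nonempty ∧
      (M.shift Ξ).wtildeStrictSet = ∅ ∧
      (∀ ξ : ℝ, ξ < Ξ → (M.shift ξ).wtildeStrictSet.Nonempty) ∧
      (∀ X ∈ M.solutionSet, IsGreatest (M.xiFeasible X) (M.xiStar X)) ∧
      IsLUB (M.xiStar '' M.solutionSet) Ξ := by
  have hm := hmin.pos hn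
  obtain ⟨Ξ, -, hΞ1, ⟨X, hX, hXΞ⟩, hmax⟩ :=
    hmin.exists_maximal_feasible hn (hpass.wtildeSet_nonempty hm)
  have hstrict (ξ : ℝ) (hξ : ξ < Ξ) : X ∈ (M.shift ξ).wtildeStrictSet :=
    ⟨hX.1, (posDef_shift_Wtilde_iff (hξ.trans hΞ1)).2 (posDef_sub_smul_weight_of_lt hX.1 hXΞ hξ)⟩
  have hmem : X ∈ (M.shift Ξ).wtildeSet := ⟨hX.1, (mem_xiFeasible_iff hΞ1).1 hXΞ⟩
  have hgreatest (Y) (hY : Y ∈ M.wtildeSet) := isGreatest_xiStar hn hY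
  rw [solutionSet_eq_wtildeSet]
  refine ⟨Ξ, ⟨?_, fun b hb => ?_⟩, hΞ1, isPassive_of_mem_wtildeSet hmem, ⟨X, hmem⟩, ?_,
    fun ξ hξ => ⟨X, hstrict ξ hξ⟩, hgreatest, ?_⟩
  -- The Kalman–Yakubovich–Popov lemma, applied to `M_ξ`, produces a certificate and hence a
  -- feasible level.
  · rintro ξ ⟨hξ1, hξ⟩
    obtain ⟨Y, hY, hYW⟩ := hξ.wtildeSet_nonempty hm
    exact hmax Y hY ξ ((mem_xiFeasible_iff hξ1).2 hYW)
  · exact le_of_forall_lt_imp_le_of_dense fun ξ hξ =>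
      hb ⟨hξ.trans hΞ1, isStrictlyPassive_of_mem_wtildeStrictSet (hstrict ξ hξ)⟩
  · refine Set.eq_empty_iff_forall_notMem.2 fun Y ⟨hY, hYW⟩ => ?_
    rw [posDef_shift_Wtilde_iff hΞ1] at hYW
    -- Strictness at `Ξ` would make `Ξ + ε` feasible.
    obtain ⟨ε, hε, h⟩ := hYW.exists_pos_posSemidef_sub_smul (isHermitian_weight (m := m) hY.1)
    have h1 : Ξ + ε ∈ M.xiFeasible Y := by
      rw [sub_sub, ← add_smul, ← Complex.ofReal_add] at h
      exact h
    linarith [hmax Y hY _ h1]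
  · refine ⟨?_, fun b hb => ((hgreatest X hX).2 hXΞ).trans (hb ⟨X, hX, rfl⟩)⟩
    rintro _ ⟨Y, hY, rfl⟩
    exact hmax Y hY.1 _ (hgreatest Y hY).1
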